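/- Let $l\ge 2$ and $r,\gamma,u\ge 1$ be integers, $s=r+\gamma$, $v=s/(s-\gamma)$, and suppose $v>l/(l-1)$. Let $\Omega=[-1,1]^l$ with boundary $\Gamma$, and let $d(t,\Gamma)$ be the $l_\infty$-distance from $t$ to $\Gamma$. Let $\bar Q^u_{r\gamma}(\Omega,1)$ be the class of functions $f\in C^{r-1}(\Omega)$ that are $s$ times differentiable in $\Omega\setminus\Gamma$ and satisfy $$|D^\alpha f(t)|\le 1\ \ (t\in\Omega,\ |\alpha|\le r-1),\qquad |D^\alpha f(t)|\le 1+|\ln^u d(t,\Gamma)|\ \ (t\in\Omega\setminus\Gamma,\ |\alpha|=r),$$ $$|D^\alpha f(t)|\le \frac{1+|\ln^{u-1} d(t,\Gamma)|}{d(t,\Gamma)^{|\alpha|-r}}\ \ (t\in\Omega\setminus\Gamma,\ r<|\alpha|\le s).$$ For a subset $X$ of a normed space $B$ let $d_n(X,B)=\inf_{L}\sup_{x\in X}\inf_{y\in L}\|x-y\|$, where $L$ runs over all $n$-dimensional subspaces of $B$; $C=C(\Omega)$ carries the maximum norm. Then there is a constant $c>0$ depending only on $l,r,\gamma,u$ such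 that the following two statements hold. (1) For all $n\ge 2$, $$d_n(\bar Q^u_{r\gamma}(\Omega,1),C)\le c\,n^{-(s-\gamma)/(l-1)}\ln^u n .$$ (2) This order is attained by continuous local splines, as follows. For $N\ge1$ put $\rho_k=(k/N)^v$ $(0\le k\le N)$, $h_k=\rho_{k+1}-\rho_k$ and $\Delta^k=\{t\in\Omega:\rho_k\le d(t,\Gamma)\le\rho_{k+1}\}$ $(0\le k\le N-1)$. A graded partition consists of finite sets $G_k\subset[-(1-\rho_k),1-\rho_k]$, each containing both endpoints $\pm(1-\rho_k)$, with $G_{N-1}=\{\pm(1-\rho_{N-1})\}$, $G_{k+1}\subseteq G_k$, and distances between neighbouring points of $G_k$ lying in $[h_k,2h_k]$; the cells of $\Delta^k$ are the products of $l$ intervals between neighbouring points of $G_k$ that are contained in $\Delta^k$. Let $n$ be the number of cells times $s^l$ (the number of nodes). For a box $Q=\prod_j[a_j,b_j]$ let $P_{s,\ldots,s}(F,Q)$ be the tensor-product polynomial of degree at most $s-1$ in each variable which interpolates $F$ at the grid whose $j$-th coordinates are the $s$ zeros of the Chebyshev polynomial of the first kind of degree $s$, mapped affinely so that the smallest and the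 largest zero go to $a_j$ and $b_j$. A local spline of $f\in C(\Omega)$ is a $g\in C(\Omega)$ which on every cell $Q$ of every $\Delta^k$ equals $P_{s,\ldots,s}(\tilde f,Q)$, where $\tilde f=g$ on $\Delta^k\cap\Delta^{k+1}$ if $k+1<N$, and $\tilde f=f$ at all other points. For every $N\ge 1$ a graded partition exists, and for every graded partition: $c^{-1}N^{v(l-1)}\le n\le cN^{v(l-1)}$; every $f\in C(\Omega)$ has exactly one local spline $Sf$; the operator $S$ is linear on $C(\Omega)$ and its range has finite dimension at most $n$; and $$\|f-Sf\|_{C(\Omega)}\le c\,n^{-(s-\gamma)/(l-1)}\ln^u n\qquad\text{for all } f\in\bar Q^u_{r\gamma}(\Omega,1).$$ -/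

import Mathlib

open scoped ENNReal

/-- The cube `[-1,1]^l`. The space `Fin l → ℝ` carries the sup norm. -/
abbrev cube (l : ℕ) : Set (Fin l → ℝ) := Set.Icc (fun _ => -1) (fun _ => 1)

/-- The `l_∞`-distance `d(t, Γ)` from `t` to the boundary `Γ` of the cube. -/
noncomputable def bdist {l : ℕ} (t : Fin l → ℝ) : ℝ := Metric.infDist t (frontier (cube l))

/-- Functions on the cube that lie in the class `Q̄^u_{rγ}([-1,1]^l, 1)`, with `s = r + γ`.
A partial derivative of order `m` is written as the `m`-th derivative evaluated at
`m` coordinate vectors `e_{j 0}, …, e_{j (m-1)}`; every `D^v` with `|v| = m` has this form.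
In the interior `f` is only asked to be `s` times differentiable, so that all the `D^v f` with
`|v| ≤ s` exist; the derivatives of order `s` need not be continuous. -/
structure IsQbar (l r γ u : ℕ) (f : (Fin l → ℝ) → ℝ) : Prop where
  contDiffOn : ContDiffOn ℝ ((r - 1 : ℕ) : ℕ∞) f (cube l)
  bound_low : ∀ m ≤ r - 1, ∀ j : Fin m → Fin l, ∀ t ∈ cube l,
    |iteratedFDerivWithin ℝ m f (cube l) t (fun i => Pi.single (j i) 1)| ≤ 1
  differentiableOn : ∀ m < r + γ,
    DifferentiableOn ℝ (iteratedFDeriv ℝ m f) (interior (cube l))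
  bound_mid : ∀ j : Fin r → Fin l, ∀ t ∈ interior (cube l),
    |iteratedFDeriv ℝ r f t (fun i => Pi.single (j i) 1)| ≤ 1 + |Real.log (bdist t) ^ u|
  bound_high : ∀ m, r < m → m ≤ r + γ → ∀ j : Fin m → Fin l, ∀ t ∈ interior (cube l),
    |iteratedFDeriv ℝ m f t (fun i => Pi.single (j i) 1)| ≤
      (1 + |Real.log (bdist t) ^ (u - 1)|) / bdist t ^ (m - r)

/-- The class `Q̄^u_{rγ}([-1,1]^l, 1)` as a subset of `C([-1,1]^l)`. -/
def Qbar (l r γ u : ℕ) : Set C(cube l, ℝ) :=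
  {g | ∃ f : (Fin l → ℝ) → ℝ, IsQbar l r γ u f ∧ ∀ t : cube l, g t = f t}

/-- The Kolmogorov width `d_n(X, B)`: the infimum over all `n`-dimensional subspaces `L` of `B`
of the supremum over `x ∈ X` of the distance from `x` to `L`. -/
noncomputable def kolmogorovWidth {B : Type*} [NormedAddCommGroup B] [NormedSpace ℝ B]
    (n : ℕ) (X : Set B) : ℝ≥0∞ :=
  ⨅ (L : Submodule ℝ B) (_ : FiniteDimensional ℝ L ∧ Module.finrank ℝ L = n),
    ⨆ x ∈ X, Metric.infEDist x (L : Set B)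

/-! ### Interpolation at stretched Chebyshev nodes -/

/-- The zeros `-cos ((2i+1)π/(2s))`, `i = 0, …, s-1`, of the Chebyshev polynomial of the first
kind of degree `s`, mapped affinely so that the smallest one goes to `a` and the largest to `b`. -/
noncomputable def chebNode (s : ℕ) (a b : ℝ) (i : Fin s) : ℝ :=
  (a + b) / 2 - (b - a) / 2 *
    (Real.cos ((2 * (i : ℝ) + 1) * Real.pi / (2 * s)) / Real.cos (Real.pi / (2 * s)))

/-- The box `∏ⱼ [(Q j).1, (Q j).2]`. -/
def box {l : ℕ} (Q : Fin l → ℝ × ℝ) : Set (Fin l → ℝ) :=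
  {t | ∀ j, (Q j).1 ≤ t j ∧ t j ≤ (Q j).2}

/-- The tensor-product interpolation polynomial `P_{s,…,s}(F, Q)` of a function `F` on the
box `Q`, of degree at most `s - 1` in each variable, as a function of `t`. -/
noncomputable def tensorInterp (s : ℕ) {l : ℕ} (F : (Fin l → ℝ) → ℝ) (Q : Fin l → ℝ × ℝ)
    (t : Fin l → ℝ) : ℝ :=
  ∑ i : Fin l → Fin s, F (fun j => chebNode s (Q j).1 (Q j).2 (i j)) *
    ∏ j, (Lagrange.basis Finset.univ (chebNode s (Q j).1 (Q j).2) (i j)).eval (t j)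

/-! ### Boundary-graded partitions of the cube -/

/-- The radii `(k/N)^v`. -/
noncomputable def gradRadius (v : ℝ) (N k : ℕ) : ℝ := ((k : ℝ) / N) ^ v

/-- The widths `h_k = ((k+1)/N)^v - (k/N)^v`. -/
noncomputable def gradStep (v : ℝ) (N k : ℕ) : ℝ := gradRadius v N (k + 1) - gradRadius v N k

/-- The layers `Δ^k = {t : (k/N)^v ≤ d(t, Γ) ≤ ((k+1)/N)^v}`, `k = 0, …, N-1`. -/
def layer (l : ℕ) (v : ℝ) (N k : ℕ) : Set (Fin l → ℝ) :=
  {t | t ∈ cube l ∧ gradRadius v N k ≤ bdist t ∧ bdist t ≤ gradRadius v N (k + 1)}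

/-- The pairs of neighbouring points of a finite set of reals. -/
def intervals (G : Finset ℝ) : Set (ℝ × ℝ) :=
  {p | p.1 ∈ G ∧ p.2 ∈ G ∧ p.1 < p.2 ∧ ∀ x ∈ G, ¬ (p.1 < x ∧ x < p.2)}

/-- A boundary-graded partition. The layer `Δ^k` is cut by the planes `t_j = x`, where `j` is any
coordinate and `x` any point of `pts k`. The innermost layer is one cube, the planes
that cut a layer also cut the next layer towards the boundary, and the
edges of the cells in `Δ^k` have lengths between `h_k` and `2 h_k`. -/
structure GradedPartition (v : ℝ) (N : ℕ) where
  pts : ℕ → Finset ℝ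
  innermost : pts (N - 1) = {-(1 - gradRadius v N (N - 1)), 1 - gradRadius v N (N - 1)}
  abs_le : ∀ k < N, ∀ x ∈ pts k, |x| ≤ 1 - gradRadius v N k
  left_mem : ∀ k < N, -(1 - gradRadius v N k) ∈ pts k
  right_mem : ∀ k < N, 1 - gradRadius v N k ∈ pts k
  nested : ∀ k, k + 1 < N → pts (k + 1) ⊆ pts k
  edges : ∀ k < N, ∀ p ∈ intervals (pts k),
    gradStep v N k ≤ p.2 - p.1 ∧ p.2 - p.1 ≤ 2 * gradStep v N k

namespace GradedPartition

variable {v : ℝ} {N : ℕ}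

/-- The cells of the partition that make up the layer `Δ^k`. -/
def cells (P : GradedPartition v N) (l k : ℕ) : Set (Fin l → ℝ × ℝ) :=
  {Q | (∀ j, Q j ∈ intervals (P.pts k)) ∧ box Q ⊆ layer l v N k}

/-- The number of interpolation nodes, `s^l` for each cell. -/
noncomputable def numNodes (P : GradedPartition v N) (s l : ℕ) : ℕ :=
  ∑ k ∈ Finset.range N, s ^ l * (P.cells l k).ncard

open Classical in
/-- The data interpolated on the cells of `Δ^k`: at points of the hypersurface
`Δ^k ∩ Δ^{k+1}` the value of the spline `g` itself (it is fixed there by the cells of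
`Δ^{k+1}`), at all the other points of the cube the value of `f`. -/
noncomputable def data {l : ℕ} (_P : GradedPartition v N) (f g : C(cube l, ℝ)) (k : ℕ) :
    (Fin l → ℝ) → ℝ := fun x =>
  if k + 1 < N ∧ x ∈ layer l v N k ∩ layer l v N (k + 1) then
    Function.extend Subtype.val g 0 x
  else Function.extend Subtype.val f 0 x

/-- `g` is the continuous local spline of `f`: on every cell of every layer it is the
tensor-product interpolation polynomial of the data above. Going from the
innermost layer outwards, this determines `g` from the values of `f` at the nodes. -/
def IsLocalSpline {l : ℕ} (P : GradedPartition v N) (s : ℕ) (f g : C(cube l, ℝ)) : Prop :=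
  ∀ k < N, ∀ Q ∈ P.cells l k, ∀ t : cube l, (t : Fin l → ℝ) ∈ box Q →
    g t = tensorInterp s (P.data f g k) Q t

end GradedPartition

/-! The grading exponent makes Taylor's formula equally good in every layer, up to logarithms. Put r
= s - γ, so v r = s. A cell at the boundary has edges of order h_0 = N^(-v). There only r
derivatives are used, the last with a logarithmic singularity, and the Taylor polynomial of degree r
- 1 errs by order h_0^r ln^u N = N^(-s) ln^u N, with 1 + ln N in place of ln N throughout. In layer
k ≥ 1 the edges are of order (k/N)^(v-1)/N and the distance to Γ is at least ρ_k = (k/N)^v. The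
polynomial of degree s - 1 errs by order h_k^s ρ_k^(-γ) times logarithms. Since (v-1)s = vγ, the
powers of k/N cancel and N^(-s) remains (`exists_local_approx`).

Layer k has at most order h_k^(-(l-1)) cells, that is N^(v(l-1)) (k+1)^(-(v-1)(l-1)). The assumption
v > l/(l-1) says exactly that (v-1)(l-1) > 1, so the sum over k converges and n is comparable to
N^(v(l-1)) (`le_numNodes`, `exists_numNodes_le`). Hence N^(-s) is of order n^(-r/(l-1)).

The local polynomials glue because the stretched nodes include the endpoints: on a face the
interpolant sees only the data on that face. Cells of one layer share whole faces. By nestedness,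
the part of a cell on the inner boundary of its layer lies in one cell of the next layer, whose
polynomial is reproduced there. On the outer boundary of a layer the spline depends only on f on
that boundary, so the recursion over layers really has depth one. This gives an explicit linear
formula, uniqueness (`isLocalSpline_iff`), and an error constant independent of N
(`exists_abs_sub_spline_le`).

The width bound follows by taking the range of S for a suitable N as the approximating subspace. -/

/-! ### Distance to the boundary in the sup norm -/

theorem cube_eq_closedBall (l : ℕ) : cube l = Metric.closedBall 0 1 := by
  ext t
  simp only [cube, Set.mem_Icc, Pi.le_def, mem_closedBall_zero_iff,
    pi_norm_le_iff_of_nonneg zero_le_one, Real.norm_eq_abs, abs_le, forall_and]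

theorem mem_cube_iff {l : ℕ} {t : Fin l → ℝ} : t ∈ cube l ↔ ‖t‖ ≤ 1 := by
  rw [cube_eq_closedBall, mem_closedBall_zero_iff]

theorem mem_interior_cube_iff {l : ℕ} {t : Fin l → ℝ} : t ∈ interior (cube l) ↔ ‖t‖ < 1 := by
  rw [cube_eq_closedBall, interior_closedBall _ one_ne_zero, mem_ball_zero_iff]

/-- The radial projection t/‖t‖ is a nearest boundary point (a corner serves for t = 0); the
triangle inequality gives the other direction. -/
theorem bdist_eq {l : ℕ} (hl : 2 ≤ l) {t : Fin l → ℝ} (ht : t ∈ cube l) : bdist t = 1 - ‖t‖ := by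
  have : Nonempty (Fin l) := ⟨⟨0, by omega⟩⟩
  rw [mem_cube_iff] at ht
  rw [bdist, cube_eq_closedBall, frontier_closedBall _ one_ne_zero]
  have key : ∃ y ∈ Metric.sphere (0 : Fin l → ℝ) 1, dist t y ≤ 1 - ‖t‖ := by
    rcases eq_or_ne t 0 with rfl | h0
    · refine ⟨fun _ => 1, by simp, by simp⟩
    · have hn : 0 < ‖t‖ := norm_pos_iff.2 h0
      refine ⟨‖t‖⁻¹ • t, by simp [norm_smul, hn.ne'], ?_⟩
      have : t - ‖t‖⁻¹ • t = (1 - ‖t‖⁻¹) • t := by rw [sub_smul, one_smul]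
      have h1 : 1 ≤ ‖t‖⁻¹ := (one_le_inv₀ hn).2 ht
      rw [dist_eq_norm, this, norm_smul, Real.norm_eq_abs, abs_of_nonpos (by linarith)]
      field_simp
      linarith
  obtain ⟨y, hy, hty⟩ := key
  refine le_antisymm ((Metric.infDist_le_dist_of_mem hy).trans hty) ?_
  refine (Metric.le_infDist ⟨y, hy⟩).2 fun z hz => ?_
  rw [mem_sphere_zero_iff_norm] at hz
  have := norm_sub_norm_le z t
  rw [dist_comm, dist_eq_norm]
  linarith

/-! ### Radii and widths of the layers -/

section gradRadius

variable {v : ℝ} {N : ℕ}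

theorem gradRadius_zero (hv : 1 ≤ v) (N : ℕ) : gradRadius v N 0 = 0 := by
  simp [gradRadius, Real.zero_rpow (by linarith : v ≠ 0)]

theorem gradRadius_self (v : ℝ) (hN : 1 ≤ N) : gradRadius v N N = 1 := by
  have : (N : ℝ) ≠ 0 := by positivity
  simp [gradRadius, this]

theorem gradRadius_nonneg (v : ℝ) (N k : ℕ) : 0 ≤ gradRadius v N k := by
  unfold gradRadius; positivity

theorem gradRadius_strictMono (hv : 1 ≤ v) (hN : 1 ≤ N) : StrictMono (gradRadius v N) := by
  intro a b hab
  have : (0 : ℝ) < N := by positivity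
  unfold gradRadius
  gcongr

theorem gradRadius_lt_one (hv : 1 ≤ v) (hN : 1 ≤ N) {k : ℕ} (hk : k < N) :
    gradRadius v N k < 1 :=
  gradRadius_self v hN ▸ gradRadius_strictMono hv hN hk

theorem gradRadius_le_one (hv : 1 ≤ v) (hN : 1 ≤ N) {k : ℕ} (hk : k ≤ N) :
    gradRadius v N k ≤ 1 :=
  gradRadius_self v hN ▸ (gradRadius_strictMono hv hN).monotone hk

theorem gradStep_pos (hv : 1 ≤ v) (hN : 1 ≤ N) (k : ℕ) : 0 < gradStep v N k :=
  sub_pos.2 (gradRadius_strictMono hv hN k.lt_succ_self)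

theorem gradStep_le_one (hv : 1 ≤ v) (hN : 1 ≤ N) {k : ℕ} (hk : k < N) : gradStep v N k ≤ 1 := by
  have := gradRadius_le_one hv hN (k := k + 1) hk
  have := gradRadius_nonneg v N k
  unfold gradStep
  linarith

/-- With x = k/(k+1), h_k = ((k+1)/N)^v (1 - x^v), and x^v ≤ x. The matching upper bound uses
Bernoulli's inequality for x^v instead. -/
theorem le_gradStep (hv : 1 ≤ v) (hN : 1 ≤ N) (k : ℕ) :
    (((k : ℝ) + 1) / N) ^ (v - 1) / N ≤ gradStep v N k := by
  have hN' : (0 : ℝ) < N := by positivity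
  have hk : (0 : ℝ) < (k : ℝ) + 1 := by positivity
  have h1 : ((k : ℝ) / (k + 1)) ^ v ≤ (k : ℝ) / (k + 1) := by
    conv_rhs => rw [← Real.rpow_one ((k : ℝ) / (k + 1))]
    rcases Nat.eq_zero_or_pos k with rfl | hk0
    · simp [Real.zero_rpow (by linarith : v ≠ 0)]
    · exact Real.rpow_le_rpow_of_exponent_ge (by positivity)
        ((div_le_one hk).2 (by linarith)) hv
  have h2 : (k : ℝ) / N = ((k : ℝ) / (k + 1)) * (((k : ℝ) + 1) / N) := by field_simp
  have h3 : (((k : ℝ) + 1) / N) ^ (v - 1) / N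
      = (((k : ℝ) + 1) / N) ^ v * (1 - (k : ℝ) / (k + 1)) := by
    rw [Real.rpow_sub_one (by positivity)]
    field_simp
    ring
  unfold gradStep gradRadius
  push_cast
  rw [h3, h2, Real.mul_rpow (by positivity) (by positivity)]
  nlinarith [Real.rpow_nonneg (by positivity : (0 : ℝ) ≤ ((k : ℝ) + 1) / N) v]

theorem gradStep_le (hv : 1 ≤ v) (hN : 1 ≤ N) (k : ℕ) :
    gradStep v N k ≤ v * ((((k : ℝ) + 1) / N) ^ (v - 1) / N) := by
  have hN' : (0 : ℝ) < N := by positivity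
  have hk : (0 : ℝ) < (k : ℝ) + 1 := by positivity
  have h1 : 1 - v / (k + 1) ≤ ((k : ℝ) / (k + 1)) ^ v := by
    have := one_add_mul_self_le_rpow_one_add (s := -1 / ((k : ℝ) + 1)) (p := v) (by
      rw [le_div_iff₀ hk]; linarith [(Nat.cast_nonneg k : (0 : ℝ) ≤ k)]) hv
    convert this using 2 <;> field_simp <;> ring
  have h2 : (k : ℝ) / N = ((k : ℝ) / (k + 1)) * (((k : ℝ) + 1) / N) := by field_simp
  have h3 : v * ((((k : ℝ) + 1) / N) ^ (v - 1) / N)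
      = (((k : ℝ) + 1) / N) ^ v * (v / (k + 1)) := by
    rw [Real.rpow_sub_one (by positivity)]
    field_simp
  unfold gradStep gradRadius
  push_cast
  rw [h3, h2, Real.mul_rpow (by positivity) (by positivity)]
  nlinarith [Real.rpow_nonneg (by positivity : (0 : ℝ) ≤ ((k : ℝ) + 1) / N) v]

/-- Midpoint convexity of x^v. This monotonicity is what lets an inner subdivision be refined
outwards. -/
theorem gradStep_le_succ (hv : 1 ≤ v) (N k : ℕ) : gradStep v N k ≤ gradStep v N (k + 1) := by
  have hx : (k : ℝ) / N ∈ Set.Ici (0 : ℝ) := Set.mem_Ici.2 (by positivity)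
  have hy : ((k : ℝ) + 2) / N ∈ Set.Ici (0 : ℝ) := Set.mem_Ici.2 (by positivity)
  have h := (convexOn_rpow hv).2 hx hy (by norm_num : (0 : ℝ) ≤ 1 / 2)
    (by norm_num : (0 : ℝ) ≤ 1 / 2) (by norm_num)
  have h2 : (1 / 2 : ℝ) • ((k : ℝ) / N) + (1 / 2 : ℝ) • (((k : ℝ) + 2) / N)
      = ((k : ℝ) + 1) / N := by
    simp only [smul_eq_mul]; ring
  rw [h2] at h
  simp only [smul_eq_mul] at h
  unfold gradStep gradRadius
  push_cast
  rw [show (k : ℝ) + 1 + 1 = k + 2 by ring]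
  linarith

end gradRadius

theorem mem_layer_iff {l : ℕ} (hl : 2 ≤ l) {v : ℝ} {N k : ℕ} {t : Fin l → ℝ} :
    t ∈ layer l v N k ↔ 1 - gradRadius v N (k + 1) ≤ ‖t‖ ∧ ‖t‖ ≤ 1 - gradRadius v N k := by
  have h0 := gradRadius_nonneg v N k
  constructor
  · rintro ⟨h1, h2, h3⟩
    rw [bdist_eq hl h1] at h2 h3
    exact ⟨by linarith, by linarith⟩
  · rintro ⟨h1, h2⟩
    have hc : t ∈ cube l := mem_cube_iff.2 (by linarith)
    refine ⟨hc, ?_⟩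
    rw [bdist_eq hl hc]
    exact ⟨by linarith, by linarith⟩

theorem mem_interface_iff {l : ℕ} (hl : 2 ≤ l) {v : ℝ} {N k : ℕ} (hv : 1 ≤ v) (hN : 1 ≤ N)
    {t : Fin l → ℝ} :
    t ∈ layer l v N k ∩ layer l v N (k + 1) ↔ ‖t‖ = 1 - gradRadius v N (k + 1) := by
  have h1 := gradRadius_strictMono hv hN k.lt_succ_self
  have h2 := gradRadius_strictMono hv hN (k + 1).lt_succ_self
  rw [Set.mem_inter_iff, mem_layer_iff hl, mem_layer_iff hl]
  constructor
  · rintro ⟨⟨h, -⟩, -, h'⟩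
    exact le_antisymm h' h
  · intro h
    simp only [h, Nat.succ_eq_add_one] at *
    exact ⟨⟨le_rfl, by linarith⟩, by linarith, le_rfl⟩

/-! ### Neighbouring points of a finite set -/

section intervals

variable {G : Finset ℝ}

theorem exists_interval_right {a b x : ℝ} (ha : a ∈ G) (hb : b ∈ G) (hax : a ≤ x) (hxb : x < b) :
    ∃ p ∈ intervals G, p.1 ≤ x ∧ x < p.2 := by
  have h1 : (G.filter (· ≤ x)).Nonempty := ⟨a, by simp [ha, hax]⟩
  have h2 : (G.filter (x < ·)).Nonempty := ⟨b, by simp [hb, hxb]⟩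
  obtain ⟨m1, m2⟩ := Finset.mem_filter.1 (Finset.max'_mem _ h1)
  obtain ⟨m3, m4⟩ := Finset.mem_filter.1 (Finset.min'_mem _ h2)
  refine ⟨(_, _), ⟨m1, m3, m2.trans_lt m4, fun y hy h => ?_⟩, m2, m4⟩
  rcases le_or_gt y x with hyx | hyx
  · exact absurd h.1 (not_lt.2 (Finset.le_max' _ _ (Finset.mem_filter.2 ⟨hy, hyx⟩)))
  · exact absurd h.2 (not_lt.2 (Finset.min'_le _ _ (Finset.mem_filter.2 ⟨hy, hyx⟩)))

theorem exists_interval_left {a b x : ℝ} (ha : a ∈ G) (hb : b ∈ G) (hax : a < x) (hxb : x ≤ b) :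
    ∃ p ∈ intervals G, p.1 < x ∧ x ≤ p.2 := by
  have h1 : (G.filter (· < x)).Nonempty := ⟨a, by simp [ha, hax]⟩
  have h2 : (G.filter (x ≤ ·)).Nonempty := ⟨b, by simp [hb, hxb]⟩
  obtain ⟨m1, m2⟩ := Finset.mem_filter.1 (Finset.max'_mem _ h1)
  obtain ⟨m3, m4⟩ := Finset.mem_filter.1 (Finset.min'_mem _ h2)
  refine ⟨(_, _), ⟨m1, m3, m2.trans_le m4, fun y hy h => ?_⟩, m2, m4⟩
  rcases lt_or_ge y x with hyx | hyx
  · exact absurd h.1 (not_lt.2 (Finset.le_max' _ _ (Finset.mem_filter.2 ⟨hy, hyx⟩)))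
  · exact absurd h.2 (not_lt.2 (Finset.min'_le _ _ (Finset.mem_filter.2 ⟨hy, hyx⟩)))

theorem exists_interval {a b x : ℝ} (ha : a ∈ G) (hb : b ∈ G) (hab : a < b) (hax : a ≤ x)
    (hxb : x ≤ b) : ∃ p ∈ intervals G, p.1 ≤ x ∧ x ≤ p.2 := by
  rcases hxb.lt_or_eq with h | rfl
  · obtain ⟨p, hp, h1, h2⟩ := exists_interval_right ha hb hax h
    exact ⟨p, hp, h1, h2.le⟩
  · obtain ⟨p, hp, h1, h2⟩ := exists_interval_left ha hb hab le_rfl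
    exact ⟨p, hp, h1.le, h2⟩

theorem intervals_le_or_ge {p : ℝ × ℝ} (hp : p ∈ intervals G) {x : ℝ} (hx : x ∈ G) :
    x ≤ p.1 ∨ p.2 ≤ x := by
  by_contra! h
  exact hp.2.2.2 x hx h

/-- Two intervals that share a point coincide, or the point is a common endpoint. -/
theorem intervals_eq_or_endpoint {p q : ℝ × ℝ} (hp : p ∈ intervals G) (hq : q ∈ intervals G)
    {x : ℝ} (hxp : p.1 ≤ x ∧ x ≤ p.2) (hxq : q.1 ≤ x ∧ x ≤ q.2) :
    p = q ∨ ((x = p.1 ∨ x = p.2) ∧ (x = q.1 ∨ x = q.2)) := by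
  rcases intervals_le_or_ge hp hq.1 with h1 | h1
  · rcases intervals_le_or_ge hp hq.2.1 with h2 | h2
    · exact Or.inr ⟨Or.inl (by linarith), Or.inr (by linarith)⟩
    · rcases intervals_le_or_ge hq hp.1 with h3 | h3
      · rcases intervals_le_or_ge hq hp.2.1 with h4 | h4
        · have := hp.2.2.1
          linarith
        · exact Or.inl (Prod.ext (le_antisymm h3 h1) (le_antisymm h2 h4))
      · have := hp.2.2.1
        linarith
  · exact Or.inr ⟨Or.inr (by linarith), Or.inl (by linarith)⟩

theorem intervals_finite (G : Finset ℝ) : (intervals G).Finite :=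
  (G ×ˢ G).finite_toSet.subset fun p hp => by
    simpa using ⟨hp.1, hp.2.1⟩

theorem intervals_ncard_le_card (G : Finset ℝ) : (intervals G).ncard ≤ G.card := by
  rw [← Set.ncard_coe_finset]
  refine Set.ncard_le_ncard_of_injOn Prod.fst (fun p hp => hp.1) ?_ G.finite_toSet
  intro p hp q hq h
  refine Prod.ext h ?_
  have h1 := hp.2.2.1
  have h2 := hq.2.2.1
  rcases intervals_le_or_ge hp hq.2.1 with h3 | h3
  · linarith
  · rcases intervals_le_or_ge hq hp.2.1 with h4 | h4
    · linarith
    · exact le_antisymm h3 h4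

theorem le_sub_of_mem_of_intervals {h : ℝ} (hG : ∀ p ∈ intervals G, h ≤ p.2 - p.1) {x y : ℝ}
    (hx : x ∈ G) (hy : y ∈ G) (hxy : x < y) : h ≤ y - x := by
  obtain ⟨p, hp, h1, h2⟩ := exists_interval_right hx hy le_rfl hxy
  have h3 := (intervals_le_or_ge hp hx).resolve_right (not_le.2 h2)
  have h4 := (intervals_le_or_ge hp hy).resolve_left (not_le.2 (h1.trans_lt hxy))
  linarith [hG p hp]

/-- Cutting [-R, R] into pieces of length h puts at most one point in each piece. -/
theorem card_le_of_separated {R h : ℝ} (hh : 0 < h) (hR : ∀ x ∈ G, |x| ≤ R)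
    (hG : ∀ x ∈ G, ∀ y ∈ G, x < y → h ≤ y - x) : G.card ≤ ⌊2 * R / h⌋₊ + 1 := by
  rw [← Finset.card_range (⌊2 * R / h⌋₊ + 1)]
  refine Finset.card_le_card_of_injOn (fun x => ⌊(x + R) / h⌋₊) ?_ ?_
  · intro x hx
    have := (abs_le.1 (hR x hx)).2
    simp only [Finset.coe_range, Set.mem_Iio, Order.lt_add_one_iff]
    exact Nat.floor_mono (by gcongr; linarith)
  · have key : ∀ x ∈ G, ∀ y ∈ G, x < y → ⌊(x + R) / h⌋₊ ≠ ⌊(y + R) / h⌋₊ := by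
      intro x hx y hy hxy he
      have h0 : 0 ≤ (x + R) / h := div_nonneg (by linarith [(abs_le.1 (hR x hx)).1]) hh.le
      have h1 := Nat.floor_le h0
      have h2 := Nat.lt_floor_add_one ((y + R) / h)
      have h3 : (x + R) / h + 1 ≤ (y + R) / h := by
        rw [div_add_one hh.ne']
        exact div_le_div_of_nonneg_right (by linarith [hG x hx y hy hxy]) hh.le
      rw [he] at h1
      linarith
    intro x hx y hy he
    rcases lt_trichotomy x y with h | h | h
    · exact absurd he (key x hx y hy h)
    · exact h
    · exact absurd he.symm (key y hy x hx h)

/-- The gaps cover [a, b]; compare Lebesgue measures. -/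
theorem sub_le_ncard_intervals_mul {a b h : ℝ} (ha : a ∈ G) (hb : b ∈ G) (hab : a < b)
    (hh : 0 ≤ h) (hG : ∀ p ∈ intervals G, p.2 - p.1 ≤ h) :
    b - a ≤ (intervals G).ncard * h := by
  have hsub : Set.Icc a b ⊆ ⋃ p ∈ (intervals_finite G).toFinset, Set.Icc p.1 p.2 := by
    intro x hx
    obtain ⟨p, hp, h1⟩ := exists_interval ha hb hab hx.1 hx.2
    simp only [Set.mem_iUnion]
    exact ⟨p, by simpa using hp, h1⟩
  have h1 := (MeasureTheory.measure_mono (μ := MeasureTheory.volume) hsub).trans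
    (MeasureTheory.measure_biUnion_finset_le _ _)
  have h2 : ∑ p ∈ (intervals_finite G).toFinset, MeasureTheory.volume (Set.Icc p.1 p.2)
      ≤ ∑ p ∈ (intervals_finite G).toFinset, ENNReal.ofReal h := by
    refine Finset.sum_le_sum fun p hp => ?_
    rw [Real.volume_Icc]
    exact ENNReal.ofReal_le_ofReal (hG p (by simpa using hp))
  have h3 := h1.trans h2
  rw [Real.volume_Icc, Finset.sum_const, nsmul_eq_mul, ← Set.ncard_eq_toFinset_card _ (intervals_finite G),
    ← ENNReal.ofReal_natCast, ← ENNReal.ofReal_mul (by positivity)] at h3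
  exact (ENNReal.ofReal_le_ofReal_iff (by positivity)).1 h3

end intervals

/-- Half the edge length of the cube of all points at distance at least `(k/N)^v` from `Γ`. -/
noncomputable abbrev halfWidth (v : ℝ) (N k : ℕ) : ℝ := 1 - gradRadius v N k

theorem halfWidth_pos {v : ℝ} {N k : ℕ} (hv : 1 ≤ v) (hN : 1 ≤ N) (hk : k < N) :
    0 < halfWidth v N k :=
  sub_pos.2 (gradRadius_lt_one hv hN hk)

theorem halfWidth_succ_lt {v : ℝ} {N : ℕ} (hv : 1 ≤ v) (hN : 1 ≤ N) (k : ℕ) :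
    halfWidth v N (k + 1) < halfWidth v N k :=
  sub_lt_sub_left (gradRadius_strictMono hv hN k.lt_succ_self) 1

/-! ### Cells of a graded partition -/

namespace GradedPartition

variable {v : ℝ} {N : ℕ} (P : GradedPartition v N) {l k : ℕ}

theorem mem_intervals_bounds (hk : k < N) {p : ℝ × ℝ} (hp : p ∈ intervals (P.pts k)) :
    -halfWidth v N k ≤ p.1 ∧ p.2 ≤ halfWidth v N k :=
  ⟨(_root_.abs_le.1 (P.abs_le k hk _ hp.1)).1, (_root_.abs_le.1 (P.abs_le k hk _ hp.2.1)).2⟩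

/-- An interval of the `k`-th subdivision is contained in the next smaller cube, or is one of the
two end intervals. -/
theorem mem_intervals_cases (hk : k + 1 < N) {p : ℝ × ℝ} (hp : p ∈ intervals (P.pts k)) :
    (-halfWidth v N (k + 1) ≤ p.1 ∧ p.2 ≤ halfWidth v N (k + 1)) ∨
      p = (halfWidth v N (k + 1), halfWidth v N k) ∨
      p = (-halfWidth v N k, -halfWidth v N (k + 1)) := by
  have hb := P.mem_intervals_bounds (by omega) hp
  -- The strip outside the smaller cube has width exactly h_k, the minimal edge length, so an
  -- interval lying in the strip fills it.
  have he := (P.edges k (by omega) p hp).1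
  have hr := intervals_le_or_ge hp (P.nested k hk (P.right_mem (k + 1) hk))
  have hl := intervals_le_or_ge hp (P.nested k hk (P.left_mem (k + 1) hk))
  unfold gradStep at he
  unfold halfWidth at *
  rcases hr with hr | hr
  · exact Or.inr (Or.inl (Prod.ext (by linarith) (by linarith)))
  · rcases hl with hl | hl
    · exact Or.inl ⟨hl, hr⟩
    · exact Or.inr (Or.inr (Prod.ext (by linarith) (by linarith)))

theorem end_mem_intervals (hv : 1 ≤ v) (hk : k + 1 < N) :
    (halfWidth v N (k + 1), halfWidth v N k) ∈ intervals (P.pts k) ∧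
      (-halfWidth v N k, -halfWidth v N (k + 1)) ∈ intervals (P.pts k) := by
  have hN : 1 ≤ N := by omega
  have hlt := halfWidth_succ_lt hv hN k
  have hpos := halfWidth_pos hv hN hk
  constructor
  · obtain ⟨p, hp, h1, h2⟩ := exists_interval_right (P.nested k hk (P.right_mem (k + 1) hk))
      (P.right_mem k (by omega)) le_rfl hlt
    rcases P.mem_intervals_cases hk hp with h | h | h
    · exact absurd h.2 (not_le.2 h2)
    · exact h ▸ hp
    · rw [h] at h2
      simp only at h2
      linarith
  · obtain ⟨p, hp, h1, h2⟩ := exists_interval_left (P.left_mem k (by omega))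
      (P.nested k hk (P.left_mem (k + 1) hk)) (neg_lt_neg hlt) le_rfl
    rcases P.mem_intervals_cases hk hp with h | h | h
    · exact absurd h.1 (not_le.2 h1)
    · rw [h] at h1
      simp only at h1
      linarith
    · exact h ▸ hp

theorem norm_le_of_mem_box (hv : 1 ≤ v) (hk : k < N) {Q : Fin l → ℝ × ℝ}
    (hQ : ∀ j, Q j ∈ intervals (P.pts k)) {t : Fin l → ℝ} (ht : t ∈ box Q) :
    ‖t‖ ≤ halfWidth v N k := by
  rw [pi_norm_le_iff_of_nonneg (halfWidth_pos hv (by omega) hk).le]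
  intro j
  have := P.mem_intervals_bounds hk (hQ j)
  exact _root_.abs_le.2 ⟨this.1.trans (ht j).1, (ht j).2.trans this.2⟩

/-- The cells of a layer are the products of intervals with an end interval among the factors
(without this condition in the innermost layer). -/
theorem mem_cells_iff (hv : 1 ≤ v) (hl : 2 ≤ l) (hk : k < N) {Q : Fin l → ℝ × ℝ} :
    Q ∈ P.cells l k ↔ (∀ j, Q j ∈ intervals (P.pts k)) ∧
      (k + 1 < N → ∃ j, Q j = (halfWidth v N (k + 1), halfWidth v N k) ∨
        Q j = (-halfWidth v N k, -halfWidth v N (k + 1))) := by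
  have hN : 1 ≤ N := by omega
  refine and_congr_right fun hQ => ⟨fun hb hk' => ?_, fun h t ht => ?_⟩
  · by_contra! hne
    have hpos := halfWidth_pos hv hN hk'
    -- Without an end factor the centre of the box would lie strictly inside the next smaller cube,
    -- hence outside the layer.
    have hm : (fun j => ((Q j).1 + (Q j).2) / 2) ∈ box Q := fun j => by
      have := (hQ j).2.2.1
      constructor <;> linarith
    have hlay := ((mem_layer_iff hl).1 (hb hm)).1
    refine absurd hlay (not_le.2 ((pi_norm_lt_iff hpos).2 fun j => ?_))
    have h1 := (P.mem_intervals_cases hk' (hQ j)).resolve_right (by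
      rintro (h | h)
      exacts [(hne j).1 h, (hne j).2 h])
    have h2 := (hQ j).2.2.1
    exact abs_lt.2 ⟨by linarith, by linarith⟩
  · rw [mem_layer_iff hl]
    refine ⟨?_, P.norm_le_of_mem_box hv hk hQ ht⟩
    rcases Nat.lt_or_ge (k + 1) N with hk' | hk'
    · obtain ⟨j, hj⟩ := h hk'
      have h1 := norm_le_pi_norm t j
      rw [Real.norm_eq_abs] at h1
      refine le_trans ?_ h1
      have h2 := ht j
      rcases hj with hj | hj
      · rw [hj] at h2
        exact h2.1.trans (le_abs_self _)
      · rw [hj] at h2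
        simp only at h2
        have := neg_le_abs (t j)
        unfold halfWidth at h2
        linarith [h2.2]
    · have : k + 1 = N := by omega
      rw [this, gradRadius_self v hN]
      simp

theorem norm_mem_of_mem_box (hl : 2 ≤ l) {Q : Fin l → ℝ × ℝ} (hQ : Q ∈ P.cells l k)
    {t : Fin l → ℝ} (ht : t ∈ box Q) : halfWidth v N (k + 1) ≤ ‖t‖ ∧ ‖t‖ ≤ halfWidth v N k :=
  (mem_layer_iff hl).1 (hQ.2 ht)

theorem exists_cell (hv : 1 ≤ v) (hl : 2 ≤ l) (hk : k < N) {t : Fin l → ℝ}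
    (ht : t ∈ layer l v N k) : ∃ Q ∈ P.cells l k, t ∈ box Q := by
  have hN : 1 ≤ N := by omega
  rw [mem_layer_iff hl] at ht
  have hpos := halfWidth_pos hv hN hk
  have hcoord : ∀ j, |t j| ≤ halfWidth v N k := fun j =>
    (norm_le_pi_norm t j).trans ht.2
  have hex : ∀ j, ∃ p ∈ intervals (P.pts k), p.1 ≤ t j ∧ t j ≤ p.2 := fun j =>
    exists_interval (P.left_mem k hk) (P.right_mem k hk) (by linarith)
      (_root_.abs_le.1 (hcoord j)).1 (_root_.abs_le.1 (hcoord j)).2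
  choose Q hQ hQt using hex
  rcases Nat.lt_or_ge (k + 1) N with hk' | hk'
  · obtain ⟨hr, hle⟩ := P.end_mem_intervals hv hk'
    have hpos' := halfWidth_pos hv hN hk'
    -- A coordinate reaching the strip may have been assigned the interval on the wrong side of the
    -- strip's inner edge, so its factor is replaced by the end interval.
    obtain ⟨j, hj⟩ : ∃ j, halfWidth v N (k + 1) ≤ |t j| := by
      by_contra! h
      exact absurd ht.1 (not_le.2 ((pi_norm_lt_iff hpos').2 h))
    have hc := _root_.abs_le.1 (hcoord j)
    rcases le_abs.1 hj with h | h
    · refine ⟨Function.update Q j (halfWidth v N (k + 1), halfWidth v N k),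
        (P.mem_cells_iff hv hl hk).2 ⟨fun i => ?_, fun _ => ⟨j, Or.inl (by simp)⟩⟩, fun i => ?_⟩
      all_goals
        rcases eq_or_ne i j with rfl | hij
        · simp only [Function.update_self]
          first | exact hr | exact ⟨h, hc.2⟩
        · simp only [Function.update_of_ne hij]
          first | exact hQ i | exact hQt i
    · refine ⟨Function.update Q j (-halfWidth v N k, -halfWidth v N (k + 1)),
        (P.mem_cells_iff hv hl hk).2 ⟨fun i => ?_, fun _ => ⟨j, Or.inr (by simp)⟩⟩, fun i => ?_⟩
      all_goals
        rcases eq_or_ne i j with rfl | hij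
        · simp only [Function.update_self]
          first | exact hle | exact ⟨hc.1, by linarith⟩
        · simp only [Function.update_of_ne hij]
          first | exact hQ i | exact hQt i
  · exact ⟨Q, (P.mem_cells_iff hv hl hk).2 ⟨hQ, fun h => absurd h (by omega)⟩, hQt⟩

theorem cells_finite (P : GradedPartition v N) (l k : ℕ) : (P.cells l k).Finite :=
  (Set.Finite.pi' fun _ => intervals_finite (P.pts k)).subset fun _ hQ => hQ.1

/-- The part of a cell that lies on the inner boundary of its layer is covered by a cell of the
next layer; that cell also contains all points of the supporting faces of the cell. -/
theorem exists_inner_cell (hv : 1 ≤ v) (hl : 2 ≤ l) (hk : k + 1 < N) {Q : Fin l → ℝ × ℝ}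
    (hQ : Q ∈ P.cells l k) {t : Fin l → ℝ} (ht : t ∈ box Q)
    (htn : ‖t‖ = halfWidth v N (k + 1)) :
    ∃ Q' ∈ P.cells l (k + 1), ∀ x ∈ box Q,
      (∀ j, (t j = (Q j).1 ∨ t j = (Q j).2) → x j = t j) →
        x ∈ box Q' ∧ ‖x‖ = halfWidth v N (k + 1) := by
  have hN : 1 ≤ N := by omega
  have hpos := halfWidth_pos hv hN hk
  have hlt := halfWidth_succ_lt hv hN k
  obtain ⟨hQi, hQe⟩ := (P.mem_cells_iff hv hl (by omega)).1 hQ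
  have htj : ∀ j, |t j| ≤ halfWidth v N (k + 1) := fun j => htn ▸ norm_le_pi_norm t j
  -- A coarse interval containing the midpoint of a fine one contains all of it, by nestedness. For
  -- an end interval only its inner endpoint matters, and the adjacent coarse interval is taken.
  have hex : ∀ j, ∃ p ∈ intervals (P.pts (k + 1)),
      (-halfWidth v N (k + 1) ≤ (Q j).1 ∧ (Q j).2 ≤ halfWidth v N (k + 1) →
        p.1 ≤ (Q j).1 ∧ (Q j).2 ≤ p.2) ∧
      (Q j = (halfWidth v N (k + 1), halfWidth v N k) → p.2 = halfWidth v N (k + 1)) ∧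
      (Q j = (-halfWidth v N k, -halfWidth v N (k + 1)) → p.1 = -halfWidth v N (k + 1)) := by
    intro j
    rcases P.mem_intervals_cases hk (hQi j) with h | h | h
    · have hj := (hQi j).2.2.1
      obtain ⟨p, hp, h1, h2⟩ := exists_interval (x := ((Q j).1 + (Q j).2) / 2)
        (P.left_mem (k + 1) hk) (P.right_mem (k + 1) hk) (by linarith) (by linarith) (by linarith)
      have h3 := intervals_le_or_ge (hQi j) (P.nested k hk hp.1)
      have h4 := intervals_le_or_ge (hQi j) (P.nested k hk hp.2.1)
      refine ⟨p, hp, fun _ => ⟨h3.resolve_right (by intro h; linarith),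
        h4.resolve_left (by intro h; linarith)⟩, fun h' => ?_, fun h' => ?_⟩
      · rw [h'] at h
        simp only at h
        linarith
      · rw [h'] at h
        simp only at h
        linarith
    · obtain ⟨p, hp, h1, h2⟩ := exists_interval_left
        (P.left_mem (k + 1) hk) (P.right_mem (k + 1) hk) (by linarith) le_rfl
      refine ⟨p, hp, fun h' => ?_, fun _ => ?_, fun h' => ?_⟩
      · rw [h] at h'
        simp only at h'
        linarith
      · exact le_antisymm (P.mem_intervals_bounds hk hp).2 h2
      · rw [h, Prod.mk.injEq] at h'
        linarith
    · obtain ⟨p, hp, h1, h2⟩ := exists_interval_right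
        (P.left_mem (k + 1) hk) (P.right_mem (k + 1) hk) le_rfl (by linarith)
      refine ⟨p, hp, fun h' => ?_, fun h' => ?_, fun _ => ?_⟩
      · rw [h] at h'
        simp only at h'
        linarith
      · rw [h, Prod.mk.injEq] at h'
        linarith
      · exact le_antisymm h1 (P.mem_intervals_bounds hk hp).1
  choose Q' hQ' hin hri hle using hex
  refine ⟨Q', (P.mem_cells_iff hv hl hk).2 ⟨hQ', fun hk' => ?_⟩, fun x hx hxt => ?_⟩
  · obtain ⟨j, hj⟩ := hQe hk
    have hlt' := halfWidth_succ_lt hv hN (k + 1)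
    refine ⟨j, (P.mem_intervals_cases hk' (hQ' j)).resolve_left fun h => ?_⟩
    rcases hj with hj | hj
    · have := hri j hj
      linarith [h.2]
    · have := hle j hj
      linarith [h.1]
  -- In an end factor the condition on ‖t‖ pins t j to the inner endpoint; t j is then an endpoint
  -- of the factor, so x j is pinned too.
  · have hend : ∀ j, (Q j = (halfWidth v N (k + 1), halfWidth v N k) →
          x j = halfWidth v N (k + 1)) ∧
        (Q j = (-halfWidth v N k, -halfWidth v N (k + 1)) → x j = -halfWidth v N (k + 1)) := by
      intro j
      have h1 := _root_.abs_le.1 (htj j)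
      have h2 := ht j
      constructor
      · intro h
        rw [h] at h2
        have h3 : t j = halfWidth v N (k + 1) := le_antisymm h1.2 h2.1
        rw [hxt j (Or.inl (by rw [h, h3])), h3]
      · intro h
        rw [h] at h2
        have h3 : t j = -halfWidth v N (k + 1) := le_antisymm h2.2 h1.1
        rw [hxt j (Or.inr (by rw [h, h3])), h3]
    have hxle : ‖x‖ ≤ halfWidth v N (k + 1) := by
      rw [pi_norm_le_iff_of_nonneg hpos.le]
      intro j
      rw [Real.norm_eq_abs, _root_.abs_le]
      rcases P.mem_intervals_cases hk (hQi j) with h | h | h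
      · exact ⟨h.1.trans (hx j).1, (hx j).2.trans h.2⟩
      · rw [(hend j).1 h]
        constructor <;> linarith
      · rw [(hend j).2 h]
        constructor <;> linarith
    refine ⟨fun j => ?_, le_antisymm hxle (P.norm_mem_of_mem_box hl hQ hx).1⟩
    rcases P.mem_intervals_cases hk (hQi j) with h | h | h
    · exact ⟨(hin j h).1.trans (hx j).1, (hx j).2.trans (hin j h).2⟩
    · have := hri j h
      have h' := (hQ' j).2.2.1
      rw [(hend j).1 h]
      constructor <;> linarith
    · have := hle j h
      have h' := (hQ' j).2.2.1
      rw [(hend j).2 h]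
      constructor <;> linarith

end GradedPartition

/-! ### Existence of graded partitions -/

/-- Between two finite sets of reals: every `h`-separated finite subset of `[-R, R]` extends to
one whose gaps have length at most `2 h`. -/
theorem exists_superset_intervals_le {R h : ℝ} (hh : 0 < h) (G : Finset ℝ)
    (hR : ∀ x ∈ G, |x| ≤ R) (hG : ∀ x ∈ G, ∀ y ∈ G, x < y → h ≤ y - x) :
    ∃ G' : Finset ℝ, G ⊆ G' ∧ (∀ x ∈ G', |x| ≤ R) ∧
      ∀ p ∈ intervals G', h ≤ p.2 - p.1 ∧ p.2 - p.1 ≤ 2 * h := by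
  let Good : Finset ℝ → Prop := fun G' =>
    G ⊆ G' ∧ (∀ x ∈ G', |x| ≤ R) ∧ ∀ x ∈ G', ∀ y ∈ G', x < y → h ≤ y - x
  have hbdd : BddAbove (Finset.card '' {G' | Good G'}) :=
    ⟨⌊2 * R / h⌋₊ + 1, by
      rintro _ ⟨G', ⟨-, h2, h3⟩, rfl⟩
      exact card_le_of_separated hh h2 h3⟩
  obtain ⟨G', ⟨h1, h2, h3⟩, hmax⟩ := Nat.sSup_mem (s := Finset.card '' {G' | Good G'})
    ⟨_, G, ⟨subset_rfl, hR, hG⟩, rfl⟩ hbdd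
  refine ⟨G', h1, h2, fun p hp => ⟨h3 _ hp.1 _ hp.2.1 hp.2.2.1, ?_⟩⟩
  -- The extension has maximal cardinality. The midpoint of a gap longer than 2h could still be
  -- added.
  by_contra! hlt
  set m := (p.1 + p.2) / 2 with hm
  have hsep : ∀ x ∈ G', x ≤ m - h ∨ m + h ≤ x := fun x hx => by
    rcases intervals_le_or_ge hp hx with h | h
    · left; linarith
    · right; linarith
  have hmem : m ∉ G' := fun hx => by
    rcases hsep m hx with h | h <;> linarith
  have hgood : Good (insert m G') := by
    refine ⟨h1.trans (Finset.subset_insert _ _), fun x hx => ?_, fun x hx y hy hxy => ?_⟩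
    · rcases Finset.mem_insert.1 hx with rfl | hx
      · have ha := abs_le.1 (h2 _ hp.1)
        have hb := abs_le.1 (h2 _ hp.2.1)
        exact abs_le.2 ⟨by linarith, by linarith⟩
      · exact h2 x hx
    · rcases Finset.mem_insert.1 hx with rfl | hx <;> rcases Finset.mem_insert.1 hy with rfl | hy
      · exact absurd hxy (lt_irrefl _)
      · rcases hsep y hy with h | h <;> linarith
      · rcases hsep x hx with h | h <;> linarith
      · exact h3 x hx y hy hxy
  have := le_csSup hbdd ⟨_, hgood, rfl⟩
  rw [← hmax, Finset.card_insert_of_notMem hmem] at this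
  omega

/-- The conditions on the `k`-th subdivision in a graded partition. -/
structure IsSubdivision (v : ℝ) (N k : ℕ) (G : Finset ℝ) : Prop where
  abs_le : ∀ x ∈ G, |x| ≤ halfWidth v N k
  left_mem : -halfWidth v N k ∈ G
  right_mem : halfWidth v N k ∈ G
  edges : ∀ p ∈ intervals G, gradStep v N k ≤ p.2 - p.1 ∧ p.2 - p.1 ≤ 2 * gradStep v N k

/-- The inner points are h_(k+1)-separated and h_k ≤ h_(k+1); the two new endpoints lie exactly h_k
beyond the old ones. So the union is h_k-separated and extends to a subdivision. -/
theorem IsSubdivision.exists_refinement {v : ℝ} {N k : ℕ} (hv : 1 ≤ v) (hk : k + 1 < N)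
    {G : Finset ℝ} (hG : IsSubdivision v N (k + 1) G) :
    ∃ G', G ⊆ G' ∧ IsSubdivision v N k G' := by
  have hN : 1 ≤ N := by omega
  have hstep := gradStep_pos hv hN k
  have hpos := halfWidth_pos hv hN hk
  have hlt := halfWidth_succ_lt hv hN k
  have hdiff : halfWidth v N k - halfWidth v N (k + 1) = gradStep v N k := by
    unfold halfWidth gradStep; ring
  have hsep : ∀ x ∈ G, ∀ y ∈ G, x < y → gradStep v N k ≤ y - x := fun x hx y hy =>
    le_sub_of_mem_of_intervals
      (fun p hp => (gradStep_le_succ hv N k).trans (hG.edges p hp).1) hx hy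
  have hle := fun x hx => _root_.abs_le.1 (hG.abs_le x hx)
  obtain ⟨G', h1, h2, h3⟩ := exists_superset_intervals_le (R := halfWidth v N k) hstep
    (insert (halfWidth v N k) (insert (-halfWidth v N k) G)) (by
      simp only [Finset.mem_insert, forall_eq_or_imp, abs_neg]
      have : |halfWidth v N k| = halfWidth v N k := abs_of_pos (hpos.trans hlt)
      exact ⟨this.le, this.le, fun x hx => (hG.abs_le x hx).trans hlt.le⟩) (by
      intro x hx y hy hxy
      simp only [Finset.mem_insert] at hx hy
      rcases hx with rfl | rfl | hx <;> rcases hy with rfl | rfl | hy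
      · linarith
      · linarith
      · linarith [hle y hy]
      · have := hG.right_mem
        have := hle _ this
        linarith
      · linarith
      · linarith [hle y hy]
      · linarith [hle x hx]
      · linarith [hle x hx]
      · exact hsep x hx y hy hxy)
  exact ⟨G', fun x hx => h1 (by simp [hx]), h2, h1 (by simp), h1 (by simp), h3⟩

/-- Since ρ_N = 1, the half width 1 - ρ_(N-1) equals h_(N-1), so the single edge attains the upper
bound 2h_(N-1). -/
theorem isSubdivision_innermost {v : ℝ} {N : ℕ} (hv : 1 ≤ v) (hN : 1 ≤ N) :
    IsSubdivision v N (N - 1) {-halfWidth v N (N - 1), halfWidth v N (N - 1)} := by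
  have hpos := halfWidth_pos hv hN (k := N - 1) (by omega)
  have hstep : gradStep v N (N - 1) = halfWidth v N (N - 1) := by
    unfold gradStep halfWidth
    rw [Nat.sub_add_cancel hN, gradRadius_self v hN]
  refine ⟨?_, by simp, by simp, ?_⟩
  · simp only [Finset.mem_insert, Finset.mem_singleton, forall_eq_or_imp, abs_neg, forall_eq,
      and_self]
    exact (abs_of_pos hpos).le
  · rintro ⟨a, b⟩ ⟨h1, h2, h3, -⟩
    simp only [Finset.mem_insert, Finset.mem_singleton] at h1 h2 h3 ⊢
    rw [hstep]
    rcases h1 with rfl | rfl <;> rcases h2 with rfl | rfl <;> constructor <;> linarith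

theorem nonempty_gradedPartition {v : ℝ} {N : ℕ} (hv : 1 ≤ v) (hN : 1 ≤ N) :
    Nonempty (GradedPartition v N) := by
  have hstep : ∀ (k : ℕ) (G : Finset ℝ), ∃ G' : Finset ℝ,
      k + 1 < N → IsSubdivision v N (k + 1) G → G ⊆ G' ∧ IsSubdivision v N k G' := by
    intro k G
    by_cases hk : k + 1 < N ∧ IsSubdivision v N (k + 1) G
    · obtain ⟨G', h⟩ := hk.2.exists_refinement hv hk.1
      exact ⟨G', fun _ _ => h⟩
    · exact ⟨G, fun h1 h2 => absurd ⟨h1, h2⟩ hk⟩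
  choose F hF using hstep
  -- The recursion runs outwards: `A m` serves layer N - 1 - m.
  let A : ℕ → Finset ℝ := fun m =>
    Nat.rec {-halfWidth v N (N - 1), halfWidth v N (N - 1)} (fun m G => F (N - 2 - m) G) m
  have hA : ∀ m < N, IsSubdivision v N (N - 1 - m) (A m) := by
    intro m
    induction m with
    | zero => exact fun _ => isSubdivision_innermost hv hN
    | succ m ih =>
      intro hm
      have hm' : N - 1 - m = N - 2 - m + 1 := by omega
      have h := ih (by omega)
      rw [hm'] at h
      have := (hF (N - 2 - m) (A m) (by omega) h).2
      rwa [show N - 1 - (m + 1) = N - 2 - m by omega]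
  have hP : ∀ k < N, IsSubdivision v N k (A (N - 1 - k)) := fun k hk => by
    have := hA (N - 1 - k) (by omega)
    rwa [show N - 1 - (N - 1 - k) = k by omega] at this
  refine ⟨⟨fun k => A (N - 1 - k), ?_, fun k hk => (hP k hk).abs_le,
    fun k hk => (hP k hk).left_mem, fun k hk => (hP k hk).right_mem, fun k hk => ?_,
    fun k hk => (hP k hk).edges⟩⟩
  · simp only [Nat.sub_self]
    rfl
  · have h := hF k (A (N - 1 - (k + 1))) hk (hP (k + 1) hk)
    have h1 : A (N - 1 - k) = F k (A (N - 1 - (k + 1))) := by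
      rw [show N - 1 - k = (N - 1 - (k + 1)) + 1 by omega]
      change F (N - 2 - (N - 1 - (k + 1))) _ = _
      rw [show N - 2 - (N - 1 - (k + 1)) = k by omega]
    simp only [h1]
    exact h.1

/-! ### Stretched Chebyshev nodes -/

section chebNode

variable {s : ℕ}

theorem chebNode_eq_affine (s : ℕ) (a b : ℝ) (i : Fin s) :
    chebNode s a b i = a + (b - a) * chebNode s 0 1 i := by
  unfold chebNode; ring

theorem cos_pi_div_pos (hs : 2 ≤ s) : 0 < Real.cos (Real.pi / (2 * s)) := by
  have h2 : (2 : ℝ) ≤ s := by exact_mod_cast hs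
  refine Real.cos_pos_of_mem_Ioo ⟨?_, ?_⟩
  · have : 0 < Real.pi / (2 * s) := by positivity
    linarith [Real.pi_pos]
  · rw [div_lt_div_iff_of_pos_left Real.pi_pos (by positivity) (by norm_num)]
    linarith

theorem chebNode_zero_one_strictMono (hs : 2 ≤ s) : StrictMono (chebNode s 0 1) := by
  intro i j hij
  have hs0 : (0 : ℝ) < s := by positivity
  have hij' : (i : ℝ) < j := by exact_mod_cast hij
  have hj : (j : ℝ) + 1 ≤ s := by exact_mod_cast j.2
  have hcos : Real.cos ((2 * (j : ℝ) + 1) * Real.pi / (2 * s))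
      < Real.cos ((2 * (i : ℝ) + 1) * Real.pi / (2 * s)) := by
    refine Real.strictAntiOn_cos ⟨by positivity, ?_⟩ ⟨by positivity, ?_⟩ ?_
    · rw [div_le_iff₀ (by positivity)]
      nlinarith [Real.pi_pos]
    · rw [div_le_iff₀ (by positivity)]
      nlinarith [Real.pi_pos]
    · gcongr
  have := div_lt_div_of_pos_right hcos (cos_pi_div_pos hs)
  unfold chebNode
  linarith

theorem chebNode_first (hs : 2 ≤ s) (a b : ℝ) : chebNode s a b ⟨0, by omega⟩ = a := by
  have := (cos_pi_div_pos hs).ne'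
  unfold chebNode
  simp only [Nat.cast_zero, mul_zero, zero_add, one_mul, div_self this]
  ring

theorem chebNode_last (hs : 2 ≤ s) (a b : ℝ) : chebNode s a b ⟨s - 1, by omega⟩ = b := by
  have := (cos_pi_div_pos hs).ne'
  have hs0 : (s : ℝ) ≠ 0 := by positivity
  have h : (2 * ((s - 1 : ℕ) : ℝ) + 1) * Real.pi / (2 * s) = Real.pi - Real.pi / (2 * s) := by
    rw [Nat.cast_sub (by omega)]
    field_simp
    push_cast
    ring
  unfold chebNode
  simp only [h, Real.cos_pi_sub, neg_div, div_self this]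
  ring

theorem chebNode_zero_one_mem (hs : 2 ≤ s) (i : Fin s) :
    0 ≤ chebNode s 0 1 i ∧ chebNode s 0 1 i ≤ 1 := by
  have hm := (chebNode_zero_one_strictMono hs).monotone
  constructor
  · have := hm (Fin.le_def.2 (Nat.zero_le i.1) : ⟨0, by omega⟩ ≤ i)
    rwa [chebNode_first hs] at this
  · have := hm (Fin.le_def.2 (Nat.le_sub_one_of_lt i.2) : i ≤ ⟨s - 1, by omega⟩)
    rwa [chebNode_last hs] at this

theorem chebNode_mem (hs : 2 ≤ s) {a b : ℝ} (hab : a ≤ b) (i : Fin s) :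
    a ≤ chebNode s a b i ∧ chebNode s a b i ≤ b := by
  have h := chebNode_zero_one_mem hs i
  rw [chebNode_eq_affine]
  constructor <;> nlinarith

theorem chebNode_injective (hs : 2 ≤ s) {a b : ℝ} (hab : a < b) :
    Function.Injective (chebNode s a b) := by
  intro i j hij
  rw [chebNode_eq_affine, chebNode_eq_affine s a b j] at hij
  exact (chebNode_zero_one_strictMono hs).injective
    (mul_left_cancel₀ (sub_pos.2 hab).ne' (add_left_cancel hij))

end chebNode

open Polynomial in
/-- The Lagrange basis at stretched Chebyshev nodes is bounded on the interval, uniformly in the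
interval. -/
theorem exists_abs_basis_le {s : ℕ} (hs : 2 ≤ s) :
    ∃ Λ : ℝ, 0 ≤ Λ ∧ ∀ a b : ℝ, a < b → ∀ x, a ≤ x → x ≤ b → ∀ i : Fin s,
      |(Lagrange.basis Finset.univ (chebNode s a b) i).eval x| ≤ Λ := by
  -- Each factor of a basis polynomial is at most (b - a)/|ξ_i - ξ_j|, which is scale invariant;
  -- summing over i avoids a maximum.
  refine ⟨∑ i : Fin s, ∏ j ∈ Finset.univ.erase i, |chebNode s 0 1 i - chebNode s 0 1 j|⁻¹,
    Finset.sum_nonneg fun i _ => Finset.prod_nonneg fun j _ => by positivity,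
    fun a b hab x hax hxb i => ?_⟩
  refine le_trans ?_ (Finset.single_le_sum (f := fun i : Fin s =>
    ∏ j ∈ Finset.univ.erase i, |chebNode s 0 1 i - chebNode s 0 1 j|⁻¹)
    (fun i _ => Finset.prod_nonneg fun j _ => by positivity) (Finset.mem_univ i))
  rw [Lagrange.basis, eval_prod, Finset.abs_prod]
  refine Finset.prod_le_prod (fun _ _ => abs_nonneg _) fun j hj => ?_
  have hne : chebNode s 0 1 i - chebNode s 0 1 j ≠ 0 :=
    sub_ne_zero.2 ((chebNode_injective hs zero_lt_one).ne (Finset.ne_of_mem_erase hj).symm)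
  have hba : 0 < b - a := sub_pos.2 hab
  have h1 : chebNode s a b i - chebNode s a b j
      = (b - a) * (chebNode s 0 1 i - chebNode s 0 1 j) := by
    rw [chebNode_eq_affine, chebNode_eq_affine s a b j]; ring
  have h2 := chebNode_mem hs hab.le j
  have h3 : |x - chebNode s a b j| ≤ b - a := abs_le.2 ⟨by linarith, by linarith⟩
  simp only [Lagrange.basisDivisor, eval_mul, eval_C, eval_sub, eval_X, abs_mul, h1, abs_inv,
    mul_inv, abs_of_pos hba]
  calc (b - a)⁻¹ * |chebNode s 0 1 i - chebNode s 0 1 j|⁻¹ * |x - chebNode s a b j|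
      ≤ (b - a)⁻¹ * |chebNode s 0 1 i - chebNode s 0 1 j|⁻¹ * (b - a) := by gcongr
    _ = _ := by field_simp

/-- Polynomial functions of degree less than `s` in each variable. -/
def tensorPoly (s l : ℕ) : Submodule ℝ ((Fin l → ℝ) → ℝ) :=
  Submodule.span ℝ {p | ∃ q : Fin l → Polynomial ℝ, (∀ j, (q j).degree < s) ∧
    p = fun t => ∏ j, (q j).eval (t j)}

/-! ### Tensor-product interpolation -/

section tensorInterp

variable {s l : ℕ}

theorem continuous_of_mem_tensorPoly {p : (Fin l → ℝ) → ℝ} (hp : p ∈ tensorPoly s l) :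
    Continuous p := by
  induction hp using Submodule.span_induction with
  | mem p hp =>
    obtain ⟨q, -, rfl⟩ := hp
    exact continuous_finsetProd _ fun j _ => (q j).continuous.comp (continuous_apply j)
  | zero => exact continuous_zero
  | add p q _ _ hp hq => exact hp.add hq
  | smul c p _ hp => exact hp.const_smul c

theorem tensorInterp_add (F G : (Fin l → ℝ) → ℝ) (Q : Fin l → ℝ × ℝ) (t : Fin l → ℝ) :
    tensorInterp s (F + G) Q t = tensorInterp s F Q t + tensorInterp s G Q t := by
  simp only [tensorInterp, Pi.add_apply, add_mul, Finset.sum_add_distrib]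

theorem tensorInterp_smul (c : ℝ) (F : (Fin l → ℝ) → ℝ) (Q : Fin l → ℝ × ℝ) (t : Fin l → ℝ) :
    tensorInterp s (c • F) Q t = c * tensorInterp s F Q t := by
  simp only [tensorInterp, Pi.smul_apply, smul_eq_mul, mul_assoc, Finset.mul_sum]

theorem tensorInterp_sub (F G : (Fin l → ℝ) → ℝ) (Q : Fin l → ℝ × ℝ) (t : Fin l → ℝ) :
    tensorInterp s (F - G) Q t = tensorInterp s F Q t - tensorInterp s G Q t := by
  simp only [tensorInterp, Pi.sub_apply, sub_mul, Finset.sum_sub_distrib]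

theorem tensorInterp_mem_tensorPoly (hs : 2 ≤ s) (F : (Fin l → ℝ) → ℝ) {Q : Fin l → ℝ × ℝ}
    (hQ : ∀ j, (Q j).1 < (Q j).2) : tensorInterp s F Q ∈ tensorPoly s l := by
  have : tensorInterp s F Q = ∑ i : Fin l → Fin s,
      F (fun j => chebNode s (Q j).1 (Q j).2 (i j)) • fun t : Fin l → ℝ =>
        ∏ j, (Lagrange.basis Finset.univ (chebNode s (Q j).1 (Q j).2) (i j)).eval (t j) := by
    ext t
    simp only [tensorInterp, Finset.sum_apply, Pi.smul_apply, smul_eq_mul]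
  rw [this]
  refine Submodule.sum_mem _ fun i _ => Submodule.smul_mem _ _ (Submodule.subset_span
    ⟨_, fun j => ?_, rfl⟩)
  rw [Lagrange.degree_basis (chebNode_injective hs (hQ j)).injOn (Finset.mem_univ _)]
  simp only [Finset.card_univ, Fintype.card_fin]
  exact_mod_cast Nat.sub_lt (by omega) one_pos

/-- For a product of one-variable polynomials the sum over the grid factors into Lagrange
interpolations, each exact in degree below s. Linearity does the rest. -/
theorem tensorInterp_of_mem_tensorPoly (hs : 2 ≤ s) {p : (Fin l → ℝ) → ℝ}
    (hp : p ∈ tensorPoly s l) {Q : Fin l → ℝ × ℝ} (hQ : ∀ j, (Q j).1 < (Q j).2)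
    (t : Fin l → ℝ) : tensorInterp s p Q t = p t := by
  induction hp using Submodule.span_induction with
  | mem p hp =>
    obtain ⟨q, hq, rfl⟩ := hp
    have h : ∀ j, (q j).eval (t j) = ∑ i : Fin s, (q j).eval (chebNode s (Q j).1 (Q j).2 i) *
        (Lagrange.basis Finset.univ (chebNode s (Q j).1 (Q j).2) i).eval (t j) := by
      intro j
      have h1 := Lagrange.eq_interpolate (s := Finset.univ) (v := chebNode s (Q j).1 (Q j).2)
        (f := q j) (chebNode_injective hs (hQ j)).injOn (by simpa using hq j)
      conv_lhs => rw [h1]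
      simp [Lagrange.interpolate_apply, Polynomial.eval_finsetSum]
    simp only [tensorInterp, h, ← Finset.prod_mul_distrib]
    rw [Finset.prod_univ_sum, Fintype.piFinset_univ]
  | zero => simp [tensorInterp]
  | add p q _ _ hp hq => rw [tensorInterp_add, hp, hq, Pi.add_apply]
  | smul c p _ hp => rw [tensorInterp_smul, hp, Pi.smul_apply, smul_eq_mul]

theorem node_mem_box (hs : 2 ≤ s) {Q : Fin l → ℝ × ℝ} (hQ : ∀ j, (Q j).1 < (Q j).2)
    (i : Fin l → Fin s) : (fun j => chebNode s (Q j).1 (Q j).2 (i j)) ∈ box Q :=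
  fun j => chebNode_mem hs (hQ j).le (i j)

/-- The value of the interpolation polynomial at `t` depends only on the data at the nodes of the
smallest face containing `t`. -/
theorem tensorInterp_congr_face (hs : 2 ≤ s) {F G : (Fin l → ℝ) → ℝ} {Q : Fin l → ℝ × ℝ}
    {t : Fin l → ℝ}
    (h : ∀ i : Fin l → Fin s,
      (∀ j, (t j = (Q j).1 ∨ t j = (Q j).2) → chebNode s (Q j).1 (Q j).2 (i j) = t j) →
        F (fun j => chebNode s (Q j).1 (Q j).2 (i j))
          = G (fun j => chebNode s (Q j).1 (Q j).2 (i j))) :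
    tensorInterp s F Q t = tensorInterp s G Q t := by
  refine Finset.sum_congr rfl fun i _ => ?_
  by_cases hi : ∀ j, (t j = (Q j).1 ∨ t j = (Q j).2) → chebNode s (Q j).1 (Q j).2 (i j) = t j
  · rw [h i hi]
  · push Not at hi
    -- Here t j is an endpoint, hence a node, but not the node of index `i j`; the basis factor
    -- vanishes at t j.
    obtain ⟨j, hj, hne⟩ := hi
    obtain ⟨i', hi'⟩ : ∃ i' : Fin s, chebNode s (Q j).1 (Q j).2 i' = t j := by
      rcases hj with hj | hj
      · exact ⟨_, (chebNode_first hs _ _).trans hj.symm⟩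
      · exact ⟨_, (chebNode_last hs _ _).trans hj.symm⟩
    have h0 : ∏ j, (Lagrange.basis Finset.univ (chebNode s (Q j).1 (Q j).2) (i j)).eval (t j)
        = 0 := by
      refine Finset.prod_eq_zero (Finset.mem_univ j) ?_
      rw [← hi']
      exact Lagrange.eval_basis_of_ne (fun h => hne (h ▸ hi')) (Finset.mem_univ _)
    rw [h0, mul_zero, mul_zero]

theorem tensorInterp_eq_of_face (hs : 2 ≤ s) {F p : (Fin l → ℝ) → ℝ} (hp : p ∈ tensorPoly s l)
    {Q : Fin l → ℝ × ℝ} (hQ : ∀ j, (Q j).1 < (Q j).2) {t : Fin l → ℝ}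
    (h : ∀ i : Fin l → Fin s,
      (∀ j, (t j = (Q j).1 ∨ t j = (Q j).2) → chebNode s (Q j).1 (Q j).2 (i j) = t j) →
        F (fun j => chebNode s (Q j).1 (Q j).2 (i j))
          = p (fun j => chebNode s (Q j).1 (Q j).2 (i j))) :
    tensorInterp s F Q t = p t :=
  (tensorInterp_congr_face hs h).trans (tensorInterp_of_mem_tensorPoly hs hp hQ t)

theorem tensorInterp_node (hs : 2 ≤ s) (F : (Fin l → ℝ) → ℝ) {Q : Fin l → ℝ × ℝ}
    (hQ : ∀ j, (Q j).1 < (Q j).2) (i : Fin l → Fin s) :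
    tensorInterp s F Q (fun j => chebNode s (Q j).1 (Q j).2 (i j))
      = F (fun j => chebNode s (Q j).1 (Q j).2 (i j)) := by
  rw [tensorInterp, Finset.sum_eq_single i]
  · rw [Finset.prod_eq_one fun j _ => Lagrange.eval_basis_self
      (chebNode_injective hs (hQ j)).injOn (Finset.mem_univ _), mul_one]
  · intro i' _ hne
    obtain ⟨j, hj⟩ := Function.ne_iff.1 hne
    rw [Finset.prod_eq_zero (Finset.mem_univ j)
      (Lagrange.eval_basis_of_ne hj (Finset.mem_univ _)), mul_zero]
  · simp

/-- Interpolants of the same data on two boxes that meet along faces agree where they meet. -/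
theorem tensorInterp_eq_of_adjacent (hs : 2 ≤ s) (F : (Fin l → ℝ) → ℝ) {Q Q' : Fin l → ℝ × ℝ}
    (hQ : ∀ j, (Q j).1 < (Q j).2) (hQ' : ∀ j, (Q' j).1 < (Q' j).2) {t : Fin l → ℝ}
    (h : ∀ j, Q' j = Q j ∨
      ((t j = (Q' j).1 ∨ t j = (Q' j).2) ∧ (t j = (Q j).1 ∨ t j = (Q j).2))) :
    tensorInterp s F Q' t = tensorInterp s F Q t := by
  -- The interpolant on Q is a tensor polynomial, and the nodes of Q' that matter at t are also
  -- nodes of Q.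
  refine tensorInterp_eq_of_face hs (tensorInterp_mem_tensorPoly hs F hQ) hQ' fun i hi => ?_
  have hex : ∀ j, ∃ i' : Fin s,
      chebNode s (Q j).1 (Q j).2 i' = chebNode s (Q' j).1 (Q' j).2 (i j) := by
    intro j
    rcases h j with h | ⟨h1, h2⟩
    · exact ⟨i j, by rw [h]⟩
    · rw [hi j h1]
      rcases h2 with hj | hj
      · exact ⟨_, (chebNode_first hs _ _).trans hj.symm⟩
      · exact ⟨_, (chebNode_last hs _ _).trans hj.symm⟩
  choose i' hi' using hex
  have := tensorInterp_node hs F hQ i'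
  simp only [hi'] at this
  exact this.symm

theorem exists_abs_tensorInterp_le (hs : 2 ≤ s) (l : ℕ) :
    ∃ Λ : ℝ, 0 ≤ Λ ∧ ∀ (F : (Fin l → ℝ) → ℝ) (Q : Fin l → ℝ × ℝ), (∀ j, (Q j).1 < (Q j).2) →
      ∀ M, (∀ x ∈ box Q, |F x| ≤ M) → ∀ t ∈ box Q, |tensorInterp s F Q t| ≤ Λ * M := by
  obtain ⟨Λ, hΛ, hb⟩ := exists_abs_basis_le hs
  refine ⟨(Fintype.card (Fin l → Fin s)) * Λ ^ l, by positivity, fun F Q hQ M hM t ht => ?_⟩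
  have hM0 : 0 ≤ M := (abs_nonneg _).trans (hM t ht)
  calc |tensorInterp s F Q t|
      ≤ ∑ _i : Fin l → Fin s, M * Λ ^ l := by
        refine (Finset.abs_sum_le_sum_abs _ _).trans (Finset.sum_le_sum fun i _ => ?_)
        rw [abs_mul, Finset.abs_prod]
        refine mul_le_mul (hM _ (node_mem_box hs hQ i)) ?_
          (Finset.prod_nonneg fun _ _ => abs_nonneg _) hM0
        calc _ ≤ ∏ _j : Fin l, Λ := Finset.prod_le_prod (fun _ _ => abs_nonneg _)
              fun j _ => hb _ _ (hQ j) _ (ht j).1 (ht j).2 _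
          _ = Λ ^ l := by simp
    _ = _ := by
        rw [Finset.sum_const, nsmul_eq_mul, Finset.card_univ]
        ring

end tensorInterp

theorem exists_mem_layer {l : ℕ} (hl : 2 ≤ l) {v : ℝ} {N : ℕ} (hv : 1 ≤ v) (hN : 1 ≤ N)
    {t : Fin l → ℝ} (ht : t ∈ cube l) : ∃ k < N, t ∈ layer l v N k := by
  have hlast : halfWidth v N (N - 1 + 1) ≤ ‖t‖ := by
    simp [halfWidth, Nat.sub_add_cancel hN, gradRadius_self v hN]
  have hex : ∃ k, halfWidth v N (k + 1) ≤ ‖t‖ := ⟨N - 1, hlast⟩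
  classical
  refine ⟨Nat.find hex, ?_, (mem_layer_iff hl).2 ⟨Nat.find_spec hex, ?_⟩⟩
  · have := Nat.find_min' hex hlast
    omega
  · rcases Nat.eq_zero_or_pos (Nat.find hex) with h0 | h0
    · rw [h0, gradRadius_zero hv]
      simpa using mem_cube_iff.1 ht
    · have := Nat.find_min hex (Nat.sub_lt h0 one_pos)
      rw [show Nat.find hex - 1 + 1 = Nat.find hex from Nat.sub_add_cancel h0] at this
      exact (not_le.1 this).le

theorem tensorInterp_congr {s l : ℕ} (hs : 2 ≤ s) {F G : (Fin l → ℝ) → ℝ} {Q : Fin l → ℝ × ℝ}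
    (hQ : ∀ j, (Q j).1 < (Q j).2) (h : ∀ x ∈ box Q, F x = G x) (t : Fin l → ℝ) :
    tensorInterp s F Q t = tensorInterp s G Q t :=
  tensorInterp_congr_face hs fun i _ => h _ (node_mem_box hs hQ i)

/-- Extension of a function on the cube by zero. -/
noncomputable def zeroExtend (l : ℕ) : C(cube l, ℝ) →ₗ[ℝ] ((Fin l → ℝ) → ℝ) where
  toFun f := Function.extend Subtype.val f 0
  map_add' f g := by
    rw [← Function.extend_add, add_zero]
    rfl
  map_smul' c f := by
    rw [← Function.extend_smul, smul_zero]
    rfl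

theorem zeroExtend_apply {l : ℕ} (f : C(cube l, ℝ)) (t : cube l) : zeroExtend l f t = f t :=
  Subtype.val_injective.extend_apply f 0 t

/-! ### The local spline operator -/

namespace GradedPartition

variable {v : ℝ} {N : ℕ} (P : GradedPartition v N) {s l k : ℕ}

theorem lt_of_mem_cells {Q : Fin l → ℝ × ℝ} (hQ : Q ∈ P.cells l k) (j : Fin l) :
    (Q j).1 < (Q j).2 :=
  (hQ.1 j).2.2.1

open Classical in
/-- A cell of the `k`-th layer that contains `x`. -/
noncomputable def cellAt (P : GradedPartition v N) (k : ℕ) (x : Fin l → ℝ) : Fin l → ℝ × ℝ :=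
  if h : ∃ Q ∈ P.cells l k, x ∈ box Q then h.choose else 0

/-- Piecewise interpolation of `F` on the `k`-th layer. -/
noncomputable def layerInterp (P : GradedPartition v N) (s : ℕ) (F : (Fin l → ℝ) → ℝ) (k : ℕ)
    (x : Fin l → ℝ) : ℝ :=
  tensorInterp s F (P.cellAt k x) x

open Classical in
/-- The data interpolated by the spline on the `k`-th layer. On the outer boundary of a layer the
spline depends on the values of `F` there only, so no recursion is needed. -/
noncomputable def splineData (P : GradedPartition v N) (s : ℕ) (F : (Fin l → ℝ) → ℝ) (k : ℕ)
    (x : Fin l → ℝ) : ℝ :=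
  if k + 1 < N ∧ ‖x‖ = halfWidth v N (k + 1) then P.layerInterp s F (k + 1) x else F x

open Classical in
/-- The local spline of `F`. -/
noncomputable def spline (P : GradedPartition v N) (s : ℕ) (F : (Fin l → ℝ) → ℝ)
    (x : Fin l → ℝ) : ℝ :=
  if h : ∃ k < N, x ∈ layer l v N k then
    P.layerInterp s (P.splineData s F h.choose) h.choose x
  else 0

/-- The chosen cell does not matter: two cells of one layer containing x agree in each coordinate or
have x at an endpoint of both. -/
theorem layerInterp_eq (hs : 2 ≤ s) (F : (Fin l → ℝ) → ℝ) {Q : Fin l → ℝ × ℝ}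
    (hQ : Q ∈ P.cells l k) {x : Fin l → ℝ} (hx : x ∈ box Q) :
    P.layerInterp s F k x = tensorInterp s F Q x := by
  have hex : ∃ Q ∈ P.cells l k, x ∈ box Q := ⟨Q, hQ, hx⟩
  obtain ⟨h1, h2⟩ := hex.choose_spec
  rw [layerInterp, cellAt, dif_pos hex]
  exact tensorInterp_eq_of_adjacent hs F (P.lt_of_mem_cells hQ) (P.lt_of_mem_cells h1)
    fun j => intervals_eq_or_endpoint (h1.1 j) (hQ.1 j) (h2 j) (hx j)

/-- On the outer boundary of a layer only data on this outer boundary matter. -/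
theorem tensorInterp_congr_outer (hv : 1 ≤ v) (hs : 2 ≤ s) (hk : k < N)
    {F G : (Fin l → ℝ) → ℝ} {Q : Fin l → ℝ × ℝ} (hQ : Q ∈ P.cells l k) {t : Fin l → ℝ}
    (ht : t ∈ box Q) (htn : ‖t‖ = halfWidth v N k)
    (h : ∀ x ∈ box Q, ‖x‖ = halfWidth v N k → F x = G x) :
    tensorInterp s F Q t = tensorInterp s G Q t := by
  have hpos := halfWidth_pos hv (by omega : 1 ≤ N) hk
  -- A coordinate attaining the norm is an endpoint of its factor. All nodes that matter at t share
  -- it, so they lie on the outer boundary.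
  obtain ⟨j, hj⟩ : ∃ j, halfWidth v N k ≤ |t j| := by
    by_contra! hlt
    exact absurd htn.ge (not_le.2 ((pi_norm_lt_iff hpos).2 hlt))
  refine tensorInterp_congr_face hs fun i hi => ?_
  have hbox := node_mem_box hs (P.lt_of_mem_cells hQ) i
  refine h _ hbox (le_antisymm (P.norm_le_of_mem_box hv hk hQ.1 hbox) ?_)
  have hb := P.mem_intervals_bounds hk (hQ.1 j)
  have htj := ht j
  have hend : t j = (Q j).1 ∨ t j = (Q j).2 := by
    rcases le_abs.1 hj with h | h
    · right; linarith
    · left; linarith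
  refine hj.trans ?_
  rw [← hi j hend]
  exact norm_le_pi_norm (fun j => chebNode s (Q j).1 (Q j).2 (i j)) j

theorem splineData_outer (hv : 1 ≤ v) (hk : k < N) (F : (Fin l → ℝ) → ℝ) {x : Fin l → ℝ}
    (hx : ‖x‖ = halfWidth v N k) : P.splineData s F k x = F x := by
  rw [splineData, if_neg]
  rintro ⟨-, h⟩
  exact (halfWidth_succ_lt hv (by omega) k).ne (h.symm.trans hx)

theorem tensorInterp_splineData_outer (hv : 1 ≤ v) (hs : 2 ≤ s) (hk : k < N)
    (F : (Fin l → ℝ) → ℝ) {Q : Fin l → ℝ × ℝ} (hQ : Q ∈ P.cells l k) {t : Fin l → ℝ}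
    (ht : t ∈ box Q) (htn : ‖t‖ = halfWidth v N k) :
    tensorInterp s (P.splineData s F k) Q t = P.layerInterp s F k t := by
  rw [P.layerInterp_eq hs F hQ ht]
  exact P.tensorInterp_congr_outer hv hs hk hQ ht htn
    fun x _ hx => P.splineData_outer hv hk F hx

/-- The nodes of Q that matter at t lie in one cell of layer k + 1, so their data come from a single
tensor polynomial, which interpolation on Q reproduces at t. -/
theorem tensorInterp_splineData_inner (hv : 1 ≤ v) (hl : 2 ≤ l) (hs : 2 ≤ s) (hk : k + 1 < N)
    (F : (Fin l → ℝ) → ℝ) {Q : Fin l → ℝ × ℝ} (hQ : Q ∈ P.cells l k) {t : Fin l → ℝ}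
    (ht : t ∈ box Q) (htn : ‖t‖ = halfWidth v N (k + 1)) :
    tensorInterp s (P.splineData s F k) Q t = P.layerInterp s F (k + 1) t := by
  obtain ⟨Q', hQ', hface⟩ := P.exists_inner_cell hv hl hk hQ ht htn
  rw [P.layerInterp_eq hs F hQ' (hface t ht fun _ _ => rfl).1]
  refine tensorInterp_eq_of_face hs (tensorInterp_mem_tensorPoly hs F (P.lt_of_mem_cells hQ'))
    (P.lt_of_mem_cells hQ) fun i hi => ?_
  obtain ⟨h1, h2⟩ := hface _ (node_mem_box hs (P.lt_of_mem_cells hQ) i) hi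
  rw [splineData, if_pos ⟨hk, h2⟩, P.layerInterp_eq hs F hQ' h1]

/-- Distinct layers meet only when consecutive. On the interface both sides equal the plain
interpolant of F on the inner layer. -/
theorem tensorInterp_splineData_eq_of_lt (hv : 1 ≤ v) (hl : 2 ≤ l) (hs : 2 ≤ s) {k' : ℕ}
    (hkk' : k < k') (hk' : k' < N) (F : (Fin l → ℝ) → ℝ) {Q Q' : Fin l → ℝ × ℝ}
    (hQ : Q ∈ P.cells l k) (hQ' : Q' ∈ P.cells l k') {t : Fin l → ℝ} (ht : t ∈ box Q)
    (ht' : t ∈ box Q') :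
    tensorInterp s (P.splineData s F k) Q t = tensorInterp s (P.splineData s F k') Q' t := by
  have hN : 1 ≤ N := by omega
  have hanti : StrictAnti (halfWidth v N) := fun a b hab =>
    sub_lt_sub_left (gradRadius_strictMono hv hN hab) 1
  have h1 := (P.norm_mem_of_mem_box hl hQ ht).1
  have h2 := (P.norm_mem_of_mem_box hl hQ' ht').2
  obtain rfl : k' = k + 1 :=
    le_antisymm (hanti.le_iff_ge.1 (h1.trans h2)) hkk'
  rw [P.tensorInterp_splineData_inner hv hl hs hk' F hQ ht (le_antisymm h2 h1),
    P.tensorInterp_splineData_outer hv hs hk' F hQ' ht' (le_antisymm h2 h1)]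

theorem spline_eq (hv : 1 ≤ v) (hl : 2 ≤ l) (hs : 2 ≤ s) (hk : k < N) (F : (Fin l → ℝ) → ℝ)
    {Q : Fin l → ℝ × ℝ} (hQ : Q ∈ P.cells l k) {t : Fin l → ℝ} (ht : t ∈ box Q) :
    P.spline s F t = tensorInterp s (P.splineData s F k) Q t := by
  have hex : ∃ k < N, t ∈ layer l v N k := ⟨k, hk, hQ.2 ht⟩
  obtain ⟨h1, h2⟩ := hex.choose_spec
  obtain ⟨Q', hQ', ht'⟩ := P.exists_cell hv hl h1 h2
  rw [spline, dif_pos hex, P.layerInterp_eq hs _ hQ' ht']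
  rcases lt_trichotomy k hex.choose with h | h | h
  · exact (P.tensorInterp_splineData_eq_of_lt hv hl hs h h1 F hQ hQ' ht ht').symm
  · rw [← P.layerInterp_eq hs _ hQ' ht', ← P.layerInterp_eq hs _ hQ ht, ← h]
  · exact P.tensorInterp_splineData_eq_of_lt hv hl hs h hk F hQ' hQ ht' ht

theorem spline_eq_layerInterp_outer (hv : 1 ≤ v) (hl : 2 ≤ l) (hs : 2 ≤ s) (hk : k < N)
    (F : (Fin l → ℝ) → ℝ) {t : Fin l → ℝ} (htn : ‖t‖ = halfWidth v N k) :
    P.spline s F t = P.layerInterp s F k t := by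
  obtain ⟨Q, hQ, ht⟩ := P.exists_cell hv hl hk (t := t) ((mem_layer_iff hl).2
    ⟨htn ▸ (halfWidth_succ_lt hv (by omega) k).le, htn.le⟩)
  rw [P.spline_eq hv hl hs hk F hQ ht, P.tensorInterp_splineData_outer hv hs hk F hQ ht htn]

/-- The cells form a finite closed cover on whose members the spline is polynomial. -/
theorem continuous_spline (hv : 1 ≤ v) (hl : 2 ≤ l) (hs : 2 ≤ s) (hN : 1 ≤ N)
    (F : (Fin l → ℝ) → ℝ) : Continuous fun t : cube l => P.spline s F t := by
  let ι := Σ k : Fin N, P.cells l k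
  have : ∀ k : Fin N, Finite (P.cells l k) := fun k => (P.cells_finite l k).to_subtype
  have hcont : ∀ Q : Fin l → ℝ × ℝ, IsClosed {t : cube l | (t : Fin l → ℝ) ∈ box Q} := by
    intro Q
    have : {t : cube l | (t : Fin l → ℝ) ∈ box Q} =
        ⋂ j, {t : cube l | (Q j).1 ≤ t.1 j} ∩ {t : cube l | t.1 j ≤ (Q j).2} := by
      ext t; simp [box]
    rw [this]
    refine isClosed_iInter fun j => IsClosed.inter ?_ ?_
    · exact isClosed_le continuous_const ((continuous_apply j).comp continuous_subtype_val)
    · exact isClosed_le ((continuous_apply j).comp continuous_subtype_val) continuous_const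
  refine (locallyFinite_of_finite fun i : ι => {t : cube l | (t : Fin l → ℝ) ∈ box i.2.1}).continuous
    ?_ (fun i => hcont _) fun i => ?_
  · refine Set.eq_univ_of_forall fun t => ?_
    obtain ⟨k, hk, hmem⟩ := exists_mem_layer hl hv hN t.2
    obtain ⟨Q, hQ, ht⟩ := P.exists_cell hv hl hk hmem
    exact Set.mem_iUnion.2 ⟨⟨⟨k, hk⟩, Q, hQ⟩, ht⟩
  · obtain ⟨⟨k, hk⟩, Q, hQ⟩ := i
    refine ContinuousOn.congr (f := fun t : cube l => tensorInterp s (P.splineData s F k) Q t)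
      ?_ fun t ht => P.spline_eq hv hl hs hk F hQ ht
    exact ((continuous_of_mem_tensorPoly (tensorInterp_mem_tensorPoly hs _
      (P.lt_of_mem_cells hQ))).comp continuous_subtype_val).continuousOn

section linear

variable (s)

theorem layerInterp_add (F G : (Fin l → ℝ) → ℝ) (k : ℕ) :
    P.layerInterp s (F + G) k = P.layerInterp s F k + P.layerInterp s G k :=
  funext fun _ => tensorInterp_add F G _ _

theorem layerInterp_smul (c : ℝ) (F : (Fin l → ℝ) → ℝ) (k : ℕ) :
    P.layerInterp s (c • F) k = c • P.layerInterp s F k :=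
  funext fun _ => tensorInterp_smul c F _ _

theorem splineData_add (F G : (Fin l → ℝ) → ℝ) (k : ℕ) :
    P.splineData s (F + G) k = P.splineData s F k + P.splineData s G k := by
  ext x
  simp only [splineData, Pi.add_apply, layerInterp_add]
  split_ifs <;> rfl

theorem splineData_smul (c : ℝ) (F : (Fin l → ℝ) → ℝ) (k : ℕ) :
    P.splineData s (c • F) k = c • P.splineData s F k := by
  ext x
  simp only [splineData, Pi.smul_apply, layerInterp_smul]
  split_ifs <;> rfl

theorem spline_add (F G : (Fin l → ℝ) → ℝ) : P.spline s (F + G) = P.spline s F + P.spline s G := by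
  ext x
  simp only [spline, Pi.add_apply, splineData_add, layerInterp_add]
  split_ifs <;> simp

theorem spline_smul (c : ℝ) (F : (Fin l → ℝ) → ℝ) : P.spline s (c • F) = c • P.spline s F := by
  ext x
  simp only [spline, Pi.smul_apply, splineData_smul, layerInterp_smul]
  split_ifs <;> simp

end linear

/-- The local spline operator. -/
noncomputable def splineMap (P : GradedPartition v N) (hv : 1 ≤ v) (hl : 2 ≤ l) (hs : 2 ≤ s)
    (hN : 1 ≤ N) : C(cube l, ℝ) →ₗ[ℝ] C(cube l, ℝ) where
  toFun f := ⟨fun t => P.spline s (zeroExtend l f) t, P.continuous_spline hv hl hs hN _⟩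
  map_add' f g := by
    ext t
    simp only [map_add, spline_add, Pi.add_apply, ContinuousMap.coe_mk, ContinuousMap.add_apply]
  map_smul' c f := by
    ext t
    simp only [map_smul, spline_smul, Pi.smul_apply, ContinuousMap.coe_mk,
      ContinuousMap.smul_apply, RingHom.id_apply]

theorem splineMap_apply (hv : 1 ≤ v) (hl : 2 ≤ l) (hs : 2 ≤ s) (hN : 1 ≤ N) (f : C(cube l, ℝ))
    (t : cube l) :
    P.splineMap hv hl hs hN f t = P.spline s (zeroExtend l f) t := rfl

theorem data_eq (hv : 1 ≤ v) (hl : 2 ≤ l) (hN : 1 ≤ N) {f g : C(cube l, ℝ)}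
    (hg : ∀ t : cube l, k + 1 < N → ‖(t : Fin l → ℝ)‖ = halfWidth v N (k + 1) →
      g t = P.layerInterp s (zeroExtend l f) (k + 1) t)
    {x : Fin l → ℝ} (hx : x ∈ cube l) :
    P.data f g k x = P.splineData s (zeroExtend l f) k x := by
  simp only [data, splineData, mem_interface_iff hl hv hN]
  split_ifs with h
  · have h1 := hg ⟨x, hx⟩ h.1 h.2
    rw [← h1]
    exact zeroExtend_apply g ⟨x, hx⟩
  · rfl

/-- The implicit condition involves g only on interfaces. There the cells of the inner layer force g
to be the plain interpolant of f, so the data, and then g, are determined. -/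
theorem isLocalSpline_iff (hv : 1 ≤ v) (hl : 2 ≤ l) (hs : 2 ≤ s) (hN : 1 ≤ N)
    (f g : C(cube l, ℝ)) : P.IsLocalSpline s f g ↔ g = P.splineMap hv hl hs hN f := by
  have hcube : ∀ k, ∀ Q ∈ P.cells l k, box Q ⊆ cube l := fun k Q hQ t ht => (hQ.2 ht).1
  constructor
  · intro h
    have hout : ∀ k, ∀ t : cube l, k < N → ‖(t : Fin l → ℝ)‖ = halfWidth v N k →
        g t = P.layerInterp s (zeroExtend l f) k t := by
      intro k t hk htn
      obtain ⟨Q, hQ, ht⟩ := P.exists_cell hv hl hk (t := t) ((mem_layer_iff hl).2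
        ⟨htn ▸ (halfWidth_succ_lt hv hN k).le, htn.le⟩)
      rw [h k hk Q hQ t ht, P.layerInterp_eq hs _ hQ ht]
      refine P.tensorInterp_congr_outer hv hs hk hQ ht htn fun x _ hx => ?_
      refine if_neg ?_
      rw [mem_interface_iff hl hv hN]
      rintro ⟨-, h⟩
      exact (halfWidth_succ_lt hv hN k).ne (h.symm.trans hx)
    ext t
    obtain ⟨k, hk, hmem⟩ := exists_mem_layer hl hv hN t.2
    obtain ⟨Q, hQ, ht⟩ := P.exists_cell hv hl hk hmem
    rw [splineMap_apply, P.spline_eq hv hl hs hk _ hQ ht, h k hk Q hQ t ht]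
    exact tensorInterp_congr hs (P.lt_of_mem_cells hQ)
      (fun x hx => P.data_eq hv hl hN (hout (k + 1)) (hcube k Q hQ hx)) _
  · rintro rfl k hk Q hQ t ht
    rw [splineMap_apply, P.spline_eq hv hl hs hk _ hQ ht]
    refine tensorInterp_congr hs (P.lt_of_mem_cells hQ)
      (fun x hx => (P.data_eq hv hl hN (fun x hk' hx => ?_) (hcube k Q hQ hx)).symm) _
    exact P.spline_eq_layerInterp_outer hv hl hs hk' _ hx

open Classical in
/-- The interpolation nodes. -/
noncomputable def nodes (P : GradedPartition v N) (s l : ℕ) : Finset (Fin l → ℝ) :=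
  (Finset.range N).biUnion fun k => (P.cells_finite l k).toFinset.biUnion fun Q =>
    Finset.univ.image fun (i : Fin l → Fin s) (j : Fin l) => chebNode s (Q j).1 (Q j).2 (i j)

theorem card_nodes_le (P : GradedPartition v N) (s l : ℕ) :
    (P.nodes s l).card ≤ P.numNodes s l := by
  classical
  refine Finset.card_biUnion_le.trans (Finset.sum_le_sum fun k _ => ?_)
  refine (Finset.card_biUnion_le_card_mul _ _ (s ^ l) fun Q _ => ?_).trans ?_
  · refine Finset.card_image_le.trans ?_
    simp
  · rw [mul_comm, Set.ncard_eq_toFinset_card _ (P.cells_finite l k)]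

theorem spline_eq_zero (hv : 1 ≤ v) (hl : 2 ≤ l) (hs : 2 ≤ s) (hN : 1 ≤ N)
    {F : (Fin l → ℝ) → ℝ} (hF : ∀ x ∈ P.nodes s l, F x = 0) {t : Fin l → ℝ} (ht : t ∈ cube l) :
    P.spline s F t = 0 := by
  have hF' : ∀ k < N, ∀ Q ∈ P.cells l k, ∀ i : Fin l → Fin s,
      F (fun j => chebNode s (Q j).1 (Q j).2 (i j)) = 0 := by
    intro k hk Q hQ i
    refine hF _ ?_
    simp only [nodes, Finset.mem_biUnion, Finset.mem_range, Set.Finite.mem_toFinset,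
      Finset.mem_image, Finset.mem_univ, true_and]
    exact ⟨k, hk, Q, hQ, i, rfl⟩
  have hzero : ∀ (Q : Fin l → ℝ × ℝ) (G : (Fin l → ℝ) → ℝ) (x : Fin l → ℝ),
      (∀ i : Fin l → Fin s, G (fun j => chebNode s (Q j).1 (Q j).2 (i j)) = 0) →
        tensorInterp s G Q x = 0 := fun Q G x h =>
    Finset.sum_eq_zero fun i _ => by rw [h i, zero_mul]
  obtain ⟨k, hk, hmem⟩ := exists_mem_layer hl hv hN ht
  obtain ⟨Q, hQ, htQ⟩ := P.exists_cell hv hl hk hmem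
  rw [P.spline_eq hv hl hs hk F hQ htQ]
  refine hzero Q _ _ fun i => ?_
  rw [splineData]
  split_ifs with h
  · obtain ⟨Q', hQ', ht'⟩ := P.exists_cell hv hl h.1 ((mem_layer_iff hl).2
      ⟨h.2 ▸ (halfWidth_succ_lt hv hN (k + 1)).le, h.2.le⟩)
    rw [P.layerInterp_eq hs F hQ' ht']
    exact hzero Q' F _ (hF' _ h.1 Q' hQ')
  · exact hF' k hk Q hQ i

/-- The operator factors through evaluation at the nodes, because the spline vanishes when F
vanishes at all of them. -/
theorem finrank_range_splineMap_le (hv : 1 ≤ v) (hl : 2 ≤ l) (hs : 2 ≤ s) (hN : 1 ≤ N) :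
    FiniteDimensional ℝ (LinearMap.range (P.splineMap (l := l) hv hl hs hN)) ∧
      Module.finrank ℝ (LinearMap.range (P.splineMap (l := l) hv hl hs hN))
        ≤ P.numNodes s l := by
  set S := P.splineMap (l := l) hv hl hs hN with hS
  let E : C(cube l, ℝ) →ₗ[ℝ] (P.nodes s l → ℝ) :=
    LinearMap.funLeft ℝ ℝ Subtype.val ∘ₗ zeroExtend l
  have hker : LinearMap.ker E ≤ LinearMap.ker S := by
    intro f hf
    rw [LinearMap.mem_ker] at hf ⊢
    ext t
    rw [hS, splineMap_apply]
    exact P.spline_eq_zero hv hl hs hN (fun x hx => congrFun hf ⟨x, hx⟩) t.2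
  have hfd : FiniteDimensional ℝ (C(cube l, ℝ) ⧸ LinearMap.ker E) :=
    E.quotKerEquivRange.symm.finiteDimensional
  rw [← Submodule.range_liftQ (LinearMap.ker E) S hker]
  refine ⟨inferInstance, (LinearMap.finrank_range_le _).trans ?_⟩
  rw [E.quotKerEquivRange.finrank_eq]
  refine (Submodule.finrank_le _).trans ?_
  rw [Module.finrank_fintype_fun_eq_card, Fintype.card_coe]
  exact P.card_nodes_le s l

end GradedPartition

/-! ### Taylor's formula up to the boundary -/

/-- Taylor's formula for a chain of derivatives, with an integrable singularity of the last one at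
the point `1`. -/
theorem abs_sub_taylor_le {φ : ℕ → ℝ → ℝ} {p : ℕ} (hp : 1 ≤ p) {x K : ℝ} (hx0 : 0 ≤ x)
    (hx1 : x < 1) (hK : 0 ≤ K)
    (hφ : ∀ m < p, ∀ y, 0 ≤ y → y ≤ x → HasDerivAt (φ m) (φ (m + 1) y) y)
    (hbd : ∀ y, 0 ≤ y → y ≤ x → |φ p y| ≤ K / √(1 - y)) :
    |φ 0 x - ∑ m ∈ Finset.range p, (m.factorial : ℝ)⁻¹ * (φ m 0 * x ^ m)| ≤ 2 * K := by
  obtain ⟨q, rfl⟩ : ∃ q, p = q + 1 := ⟨p - 1, by omega⟩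
  -- The Taylor polynomial at x as a function of its centre y: its derivative telescopes to one
  -- term, so no integral remainder or continuity of `φ p` is needed.
  let ψ : ℕ → ℝ → ℝ := fun q y =>
    ∑ m ∈ Finset.range (q + 1), (m.factorial : ℝ)⁻¹ * (φ m y * (x - y) ^ m)
  have hψ : ∀ n ≤ q, ∀ y, 0 ≤ y → y ≤ x →
      HasDerivAt (ψ n) ((n.factorial : ℝ)⁻¹ * (φ (n + 1) y * (x - y) ^ n)) y := by
    intro n
    induction n with
    | zero =>
      intro _ y h0 h1
      simpa [ψ] using hφ 0 (by omega) y h0 h1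
    | succ n ih =>
      intro hn y h0 h1
      have hd : HasDerivAt (fun y => (x - y) ^ (n + 1)) (((n + 1 : ℕ) : ℝ) * (x - y) ^ n * -1) y := by
        exact ((hasDerivAt_id y).const_sub x).pow (n + 1)
      have h2 := ((hφ (n + 1) (by omega) y h0 h1).mul hd).const_mul (((n + 1).factorial : ℝ)⁻¹)
      have h3 := (ih (by omega) y h0 h1).add h2
      have h4 : ψ (n + 1) = ψ n + fun y =>
          ((n + 1).factorial : ℝ)⁻¹ * (φ (n + 1) y * (x - y) ^ (n + 1)) := by
        ext z
        simp only [ψ, Pi.add_apply]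
        rw [Finset.sum_range_succ]
      rw [h4]
      refine h3.congr_deriv ?_
      have hf : (n.factorial : ℝ) ≠ 0 := by positivity
      rw [Nat.factorial_succ]
      push_cast
      field_simp
      ring
  have key := image_norm_le_of_norm_deriv_right_le_deriv_boundary' (a := 0) (b := x)
    (f := fun y => ψ q y - ψ q 0)
    (f' := fun y => (q.factorial : ℝ)⁻¹ * (φ (q + 1) y * (x - y) ^ q))
    -- The primitive of K/√(1 - y) vanishing at 0; it never exceeds 2K.
    (B := fun y => 2 * K - 2 * K * √(1 - y)) (B' := fun y => K / √(1 - y))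
    (fun y hy => ((hψ q le_rfl y hy.1 hy.2).sub_const _).continuousAt.continuousWithinAt)
    (fun y hy => ((hψ q le_rfl y hy.1 hy.2.le).sub_const _).hasDerivWithinAt)
    (by simp)
    (by fun_prop)
    (fun y hy => by
      have hpos : 0 < 1 - y := by linarith [hy.2]
      have := ((((hasDerivAt_id y).const_sub 1).sqrt hpos.ne').const_mul (2 * K)).const_sub (2 * K)
      refine (this.congr_deriv ?_).hasDerivWithinAt
      simp only [id]
      field_simp)
    (fun y hy => by
      have h1 : |x - y| ≤ 1 := abs_le.2 ⟨by linarith [hy.2], by linarith [hy.1]⟩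
      have h2 : (q.factorial : ℝ)⁻¹ ≤ 1 :=
        inv_le_one_of_one_le₀ (by exact_mod_cast Nat.one_le_iff_ne_zero.2 q.factorial_ne_zero)
      rw [Real.norm_eq_abs, abs_mul, abs_mul, abs_pow, abs_of_pos (by positivity)]
      calc _ ≤ 1 * (|φ (q + 1) y| * 1) := by
            gcongr
            exact pow_le_one₀ (abs_nonneg _) h1
        _ = |φ (q + 1) y| := by ring
        _ ≤ _ := hbd y hy.1 hy.2.le)
    (Set.right_mem_Icc.2 hx0)
  have h1 : ψ q x = φ 0 x := by
    simp only [ψ, sub_self]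
    rw [Finset.sum_range_succ', Finset.sum_eq_zero fun m _ => by simp]
    simp
  have h2 : ψ q 0 = ∑ m ∈ Finset.range (q + 1), (m.factorial : ℝ)⁻¹ * (φ m 0 * x ^ m) := by
    simp only [ψ, sub_zero]
  simp only [h1, h2, Real.norm_eq_abs] at key
  have := mul_nonneg hK (Real.sqrt_nonneg (1 - x))
  linarith

theorem abs_multilinear_le {l p : ℕ} (A : ContinuousMultilinearMap ℝ (fun _ : Fin p => Fin l → ℝ) ℝ)
    {K : ℝ} (hA : ∀ j : Fin p → Fin l, |A (fun i => Pi.single (j i) 1)| ≤ K) (D : Fin l → ℝ) :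
    |A (fun _ => D)| ≤ K * (l * ‖D‖) ^ p := by
  have hD : D = ∑ j, D j • (Pi.single j 1 : Fin l → ℝ) := by
    ext i
    simp [Finset.sum_apply, Pi.single_apply]
  have h1 : A (fun _ => D) = ∑ j : Fin p → Fin l, (∏ i, D (j i)) * A (fun i => Pi.single (j i) 1) := by
    conv_lhs => rw [hD]
    rw [A.map_sum]
    exact Finset.sum_congr rfl fun j _ => A.map_smul_univ _ _
  rw [h1]
  calc _ ≤ ∑ _j : Fin p → Fin l, ‖D‖ ^ p * K := by
        refine (Finset.abs_sum_le_sum_abs _ _).trans (Finset.sum_le_sum fun j _ => ?_)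
        rw [abs_mul, Finset.abs_prod]
        refine mul_le_mul ?_ (hA j) (abs_nonneg _) (by positivity)
        calc _ ≤ ∏ _i : Fin p, ‖D‖ := Finset.prod_le_prod (fun _ _ => abs_nonneg _)
              fun i _ => norm_le_pi_norm D (j i)
          _ = _ := by simp
    _ = _ := by
        simp
        ring

/-- The Taylor polynomial of `f` at `a` of degree less than `p`. -/
noncomputable def taylorPoly {l : ℕ} (f : (Fin l → ℝ) → ℝ) (p : ℕ) (a t : Fin l → ℝ) : ℝ :=
  ∑ m ∈ Finset.range p, (m.factorial : ℝ)⁻¹ * iteratedFDeriv ℝ m f a (fun _ => t - a)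

theorem taylorPoly_mem_tensorPoly {l p s : ℕ} (hps : p ≤ s) (f : (Fin l → ℝ) → ℝ)
    (a : Fin l → ℝ) : taylorPoly f p a ∈ tensorPoly s l := by
  have : taylorPoly f p a = ∑ m ∈ Finset.range p, ∑ j : Fin m → Fin l,
      ((m.factorial : ℝ)⁻¹ * iteratedFDeriv ℝ m f a (fun i => Pi.single (j i) 1)) •
        fun t : Fin l → ℝ => ∏ i, (t (j i) - a (j i)) := by
    ext t
    simp only [taylorPoly, Finset.sum_apply, Pi.smul_apply, smul_eq_mul]
    refine Finset.sum_congr rfl fun m _ => ?_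
    have hD : t - a = ∑ j, (t j - a j) • (Pi.single j 1 : Fin l → ℝ) := by
      ext i
      simp [Finset.sum_apply, Pi.single_apply]
    conv_lhs => rw [hD]
    rw [ContinuousMultilinearMap.map_sum, Finset.mul_sum]
    refine Finset.sum_congr rfl fun j _ => ?_
    rw [ContinuousMultilinearMap.map_smul_univ, smul_eq_mul]
    ring
  rw [this]
  refine Submodule.sum_mem _ fun m hm => Submodule.sum_mem _ fun j _ => Submodule.smul_mem _ _ ?_
  -- The exponent of variable i is the number of slots of j equal to i, at most m < p ≤ s.
  refine Submodule.subset_span ⟨fun i => (Polynomial.X - Polynomial.C (a i)) ^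
    (Finset.univ.filter fun i' => j i' = i).card, fun i => ?_, ?_⟩
  · rw [Polynomial.degree_pow, Polynomial.degree_X_sub_C, nsmul_eq_mul, mul_one]
    have h1 : (Finset.univ.filter fun i' => j i' = i).card ≤ m :=
      (Finset.card_filter_le _ _).trans (by simp)
    have h2 := Finset.mem_range.1 hm
    exact_mod_cast (h1.trans_lt h2).trans_le hps
  · ext t
    rw [← Finset.prod_fiberwise_of_maps_to (g := j) (t := Finset.univ) (by simp)]
    refine Finset.prod_congr rfl fun i _ => ?_
    rw [Finset.prod_congr rfl (g := fun _ => t i - a i) fun i' hi' => by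
      rw [(Finset.mem_filter.1 hi').2]]
    simp

/-- Convexity of the norm. It keeps the segment point at distance at least (1 - τ)(1 - ‖a‖) from Γ,
even when t lies on Γ. -/
theorem norm_segment_le {l : ℕ} {a t : Fin l → ℝ} (ht : ‖t‖ ≤ 1) {τ : ℝ} (h0 : 0 ≤ τ)
    (h1 : τ ≤ 1) : ‖a + τ • (t - a)‖ ≤ 1 - (1 - τ) * (1 - ‖a‖) := by
  have : a + τ • (t - a) = (1 - τ) • a + τ • t := by
    rw [smul_sub, sub_smul, one_smul]; abel
  rw [this]
  refine (norm_add_le _ _).trans ?_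
  rw [norm_smul, norm_smul, Real.norm_eq_abs, Real.norm_eq_abs, abs_of_nonneg h0,
    abs_of_nonneg (by linarith)]
  nlinarith

/-- Taylor's formula in the cube, up to the boundary. -/
theorem abs_sub_taylorPoly_le {l p : ℕ} (hp : 1 ≤ p) {f : (Fin l → ℝ) → ℝ}
    (hf : ContinuousOn f (cube l))
    (hd : ∀ m < p, DifferentiableOn ℝ (iteratedFDeriv ℝ m f) (interior (cube l)))
    {a t : Fin l → ℝ} (ha : ‖a‖ < 1) (ht : ‖t‖ ≤ 1) {K : ℝ} (hK : 0 ≤ K)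
    (hbd : ∀ τ : ℝ, 0 ≤ τ → τ < 1 → ∀ j : Fin p → Fin l,
      |iteratedFDeriv ℝ p f (a + τ • (t - a)) (fun i => Pi.single (j i) 1)| ≤ K / √(1 - τ)) :
    |f t - taylorPoly f p a t| ≤ 2 * (K * (l * ‖t - a‖) ^ p) := by
  have hseg : ∀ τ : ℝ, 0 ≤ τ → τ < 1 → ‖a + τ • (t - a)‖ < 1 := fun τ h0 h1 => by
    have := norm_segment_le (a := a) ht h0 h1.le
    nlinarith
  have hγ : ∀ τ : ℝ, HasDerivAt (fun τ : ℝ => a + τ • (t - a)) (t - a) τ := fun τ => by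
    simpa using ((hasDerivAt_id τ).smul_const (t - a)).const_add a
  -- The endpoint t may lie on Γ, where the derivatives are not controlled; the bound is proved for
  -- x < 1 and passes to the limit by continuity of f.
  have hx : ∀ x : ℝ, 0 ≤ x → x < 1 →
      |f (a + x • (t - a)) - taylorPoly f p a (a + x • (t - a))|
        ≤ 2 * (K * (l * ‖t - a‖) ^ p) := by
    intro x hx0 hx1
    have h := abs_sub_taylor_le
      (φ := fun m τ => iteratedFDeriv ℝ m f (a + τ • (t - a)) (fun _ => t - a)) hp hx0 hx1
      (K := K * (l * ‖t - a‖) ^ p) (by positivity) (fun m hm y hy0 hyx => ?_)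
      (fun y hy0 hyx => ?_)
    · convert h using 3
      · simp
      · simp only [taylorPoly]
        refine Finset.sum_congr rfl fun m _ => ?_
        have : (fun _ : Fin m => a + x • (t - a) - a) = fun i => (fun _ => x) i • (fun _ => t - a) i := by
          ext; simp
        rw [this, ContinuousMultilinearMap.map_smul_univ]
        simp [mul_comm]
    · have hmem : a + y • (t - a) ∈ interior (cube l) :=
        mem_interior_cube_iff.2 (hseg y hy0 (hyx.trans_lt hx1))
      have h1 := ((hd m hm).differentiableAt
        (isOpen_interior.mem_nhds hmem)).hasFDerivAt.comp_hasDerivAt y (hγ y)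
      have h2 := ((ContinuousMultilinearMap.apply ℝ (fun _ : Fin m => Fin l → ℝ) ℝ
        (fun _ => t - a)).hasFDerivAt).comp_hasDerivAt y h1
      rw [iteratedFDeriv_succ_apply_left]
      exact h2
    · have := abs_multilinear_le _ (hbd y hy0 (hyx.trans_lt hx1)) (t - a)
      rwa [div_mul_eq_mul_div] at this
  have hlim : Filter.Tendsto (fun x : ℝ => a + x • (t - a)) (nhdsWithin 1 (Set.Iio 1)) (nhds t) := by
    have : Continuous fun x : ℝ => a + x • (t - a) := by fun_prop
    have h2 := (this.tendsto 1).mono_left (nhdsWithin_le_nhds (s := Set.Iio 1))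
    simpa using h2
  have hev : ∀ᶠ x : ℝ in nhdsWithin 1 (Set.Iio 1), 0 ≤ x ∧ x < 1 := by
    have : Set.Ioo (0 : ℝ) 1 ∈ nhdsWithin 1 (Set.Iio 1) := Ioo_mem_nhdsLT zero_lt_one
    filter_upwards [this] with x hx
    exact ⟨hx.1.le, hx.2⟩
  have hfl : Filter.Tendsto (fun x : ℝ => f (a + x • (t - a))) (nhdsWithin 1 (Set.Iio 1))
      (nhds (f t)) := by
    refine (hf t (mem_cube_iff.2 ht)).tendsto.comp (tendsto_nhdsWithin_iff.2 ⟨hlim, ?_⟩)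
    filter_upwards [hev] with x hx
    exact mem_cube_iff.2 (hseg x hx.1 hx.2).le
  have hpl : Filter.Tendsto (fun x : ℝ => taylorPoly f p a (a + x • (t - a)))
      (nhdsWithin 1 (Set.Iio 1)) (nhds (taylorPoly f p a t)) :=
    ((continuous_of_mem_tensorPoly (taylorPoly_mem_tensorPoly le_rfl f a)).tendsto t).comp hlim
  refine le_of_tendsto (hfl.sub hpl).abs ?_
  filter_upwards [hev] with x hx'
  exact hx x hx'.1 hx'.2

/-! ### From local approximation to the spline error -/

/-- Interpolating F itself costs (1 + Λ)ε. The spline data differ from F by at most one such error,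
made in the next layer, which interpolation multiplies by Λ. The total (1 + Λ)²ε does not accumulate
over the layers. -/
theorem GradedPartition.exists_abs_sub_spline_le {s l : ℕ} (hl : 2 ≤ l) (hs : 2 ≤ s) :
    ∃ C : ℝ, 0 ≤ C ∧ ∀ {v : ℝ} {N : ℕ} (P : GradedPartition v N), 1 ≤ v → 1 ≤ N →
      ∀ (F : (Fin l → ℝ) → ℝ) (ε : ℝ),
        (∀ k < N, ∀ Q ∈ P.cells l k, ∃ p ∈ tensorPoly s l, ∀ t ∈ box Q, |F t - p t| ≤ ε) →
          ∀ t ∈ cube l, |F t - P.spline s F t| ≤ C * ε := by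
  obtain ⟨Λ, hΛ, hb⟩ := exists_abs_tensorInterp_le hs l
  refine ⟨(1 + Λ) ^ 2, by positivity, fun {v N} P hv hN F ε hp t ht => ?_⟩
  have hloc : ∀ k < N, ∀ Q ∈ P.cells l k, ∀ t ∈ box Q,
      |F t - tensorInterp s F Q t| ≤ (1 + Λ) * ε := by
    intro k hk Q hQ t ht
    obtain ⟨p, hpt, hpε⟩ := hp k hk Q hQ
    have h1 := hb (F - p) Q (P.lt_of_mem_cells hQ) ε hpε t ht
    rw [tensorInterp_sub, tensorInterp_of_mem_tensorPoly hs hpt (P.lt_of_mem_cells hQ)] at h1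
    have h2 := hpε t ht
    rw [_root_.abs_le] at h1 h2 ⊢
    constructor <;> linarith [h1.1, h1.2, h2.1, h2.2]
  obtain ⟨k, hk, hmem⟩ := exists_mem_layer hl hv hN ht
  obtain ⟨Q, hQ, htQ⟩ := P.exists_cell hv hl hk hmem
  have hε : 0 ≤ (1 + Λ) * ε := (abs_nonneg _).trans (hloc k hk Q hQ t htQ)
  have h1 := hloc k hk Q hQ t htQ
  have h2 := hb (F - P.splineData s F k) Q (P.lt_of_mem_cells hQ) ((1 + Λ) * ε) (fun x hx => by
    rw [Pi.sub_apply, GradedPartition.splineData]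
    split_ifs with h
    · obtain ⟨Q', hQ', hx'⟩ := P.exists_cell hv hl h.1 ((mem_layer_iff hl).2
        ⟨h.2 ▸ (halfWidth_succ_lt hv hN (k + 1)).le, h.2.le⟩)
      rw [P.layerInterp_eq hs F hQ' hx']
      exact hloc _ h.1 Q' hQ' x hx'
    · simpa using hε) t htQ
  rw [tensorInterp_sub] at h2
  rw [P.spline_eq hv hl hs hk F hQ htQ]
  rw [_root_.abs_le] at h1 h2 ⊢
  constructor <;> nlinarith [h1.1, h1.2, h2.1, h2.2]

/-- Raise 1 + a ≤ 2u exp(a/(2u)), with a = -ln x, to the power u. This trades the logarithmic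
singularity for an integrable square root. -/
theorem one_add_neg_log_pow_le {u : ℕ} (hu : 1 ≤ u) {x : ℝ} (hx0 : 0 < x) (hx1 : x ≤ 1) :
    (1 + -Real.log x) ^ u ≤ (2 * u) ^ u / √x := by
  have hu' : (1 : ℝ) ≤ u := by exact_mod_cast hu
  have ha : 0 ≤ -Real.log x := neg_nonneg.2 (Real.log_nonpos hx0.le hx1)
  have h1 : 1 + -Real.log x ≤ 2 * u * Real.exp (-Real.log x / (2 * u)) := by
    have := Real.add_one_le_exp (-Real.log x / (2 * u))
    calc 1 + -Real.log x ≤ 2 * u * (-Real.log x / (2 * u) + 1) := by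
          field_simp
          linarith
      _ ≤ _ := by gcongr
  have h2 : Real.exp (-Real.log x / (2 * u)) ^ u = (√x)⁻¹ := by
    rw [← Real.exp_nat_mul, Real.sqrt_eq_rpow, ← Real.rpow_neg hx0.le,
      Real.rpow_def_of_pos hx0]
    congr 1
    field_simp
  calc _ ≤ (2 * u * Real.exp (-Real.log x / (2 * u))) ^ u := by gcongr
    _ = _ := by rw [mul_pow, h2, div_eq_mul_inv]

theorem one_add_abs_log_pow_le {u : ℕ} {d e : ℝ} (hd0 : 0 < d) (he0 : 0 < e) (he1 : e ≤ 1)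
    (hed : e ≤ d) (hd1 : d ≤ 1) : 1 + |Real.log d ^ u| ≤ 2 * (1 + -Real.log e) ^ u := by
  have h1 := Real.log_le_log he0 hed
  have h2 := Real.log_nonpos hd0.le hd1
  have h3 := Real.log_nonpos he0.le he1
  have h4 : (1 : ℝ) ≤ (1 + -Real.log e) ^ u := one_le_pow₀ (by linarith)
  have h5 : |Real.log d ^ u| ≤ (1 + -Real.log e) ^ u := by
    rw [abs_pow, abs_of_nonpos h2]
    exact pow_le_pow_left₀ (by linarith) (by linarith) u
  linarith

/-! ### Local approximation on the cells -/

section midpoint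

variable {l : ℕ} {Q : Fin l → ℝ × ℝ}

/-- The centre of a box. -/
noncomputable def boxCenter (Q : Fin l → ℝ × ℝ) (j : Fin l) : ℝ := ((Q j).1 + (Q j).2) / 2

theorem boxCenter_mem (hQ : ∀ j, (Q j).1 ≤ (Q j).2) : boxCenter Q ∈ box Q := fun j => by
  have := hQ j
  unfold boxCenter
  constructor <;> linarith

theorem norm_sub_boxCenter_le {h : ℝ} (hh : 0 ≤ h) (hQ : ∀ j, (Q j).2 - (Q j).1 ≤ 2 * h)
    {t : Fin l → ℝ} (ht : t ∈ box Q) : ‖t - boxCenter Q‖ ≤ h := by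
  rw [pi_norm_le_iff_of_nonneg hh]
  intro j
  have h1 := hQ j
  have h2 := ht j
  rw [Pi.sub_apply, Real.norm_eq_abs, abs_le, boxCenter]
  constructor <;> linarith

theorem segment_mem_box {a t : Fin l → ℝ} (ha : a ∈ box Q) (ht : t ∈ box Q) {τ : ℝ} (h0 : 0 ≤ τ)
    (h1 : τ ≤ 1) : a + τ • (t - a) ∈ box Q := fun j => by
  have h2 := ha j
  have h3 := ht j
  simp only [Pi.add_apply, Pi.smul_apply, Pi.sub_apply, smul_eq_mul]
  constructor <;> nlinarith

end midpoint

/-- Local approximation on the cells that touch the boundary of the cube. -/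
theorem IsQbar.abs_sub_taylorPoly_le_boundary {l r γ u N : ℕ} {v : ℝ} (hl : 2 ≤ l) (hr : 1 ≤ r)
    (hγ : 1 ≤ γ) (hu : 1 ≤ u) (hv : 1 ≤ v) (hN : 1 ≤ N) {f : (Fin l → ℝ) → ℝ}
    (hf : IsQbar l r γ u f) (P : GradedPartition v N) {Q : Fin l → ℝ × ℝ} (hQ : Q ∈ P.cells l 0)
    {t : Fin l → ℝ} (ht : t ∈ box Q) :
    |f t - taylorPoly f r (boxCenter Q) t| ≤
      4 * ((2 * u) ^ u * (1 + -Real.log (gradStep v N 0 / 2)) ^ u) * (l * gradStep v N 0) ^ r := by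
  have hh := gradStep_pos hv hN 0
  have hh1 := gradStep_le_one hv hN (k := 0) (by omega)
  set h := gradStep v N 0 with hdef
  have hedge := fun j => P.edges 0 (by omega) _ (hQ.1 j)
  have hbds := fun j => P.mem_intervals_bounds (k := 0) (by omega) (hQ.1 j)
  simp only [halfWidth, gradRadius_zero hv, sub_zero] at hbds
  -- Every edge is at least h, so the centre stays h/2 away from Γ.
  have ha : ‖boxCenter Q‖ ≤ 1 - h / 2 := by
    rw [pi_norm_le_iff_of_nonneg (by linarith)]
    intro j
    have h1 := hedge j
    have h2 := hbds j
    rw [Real.norm_eq_abs, abs_le, boxCenter]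
    constructor <;> linarith
  have htn : ‖t‖ ≤ 1 := mem_cube_iff.1 (hQ.2 ht).1
  have hlog : 0 ≤ -Real.log (h / 2) :=
    neg_nonneg.2 (Real.log_nonpos (by positivity) (by linarith))
  have key := abs_sub_taylorPoly_le hr hf.contDiffOn.continuousOn
    (fun m hm => hf.differentiableOn m (by omega)) (by linarith : ‖boxCenter Q‖ < 1) htn
    (K := 2 * ((2 * u) ^ u * (1 + -Real.log (h / 2)) ^ u)) (by positivity) (fun τ h0 h1 j => by
      have hτ : 0 < 1 - τ := by linarith
      have hseg := norm_segment_le (a := boxCenter Q) htn h0 h1.le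
      have hle : (1 - τ) * (h / 2) ≤ 1 - ‖boxCenter Q + τ • (t - boxCenter Q)‖ := by nlinarith
      have hpos : 0 < (1 - τ) * (h / 2) := by positivity
      have hlt : ‖boxCenter Q + τ • (t - boxCenter Q)‖ < 1 := by linarith
      refine (hf.bound_mid j _ (mem_interior_cube_iff.2 hlt)).trans ?_
      rw [bdist_eq hl (mem_cube_iff.2 hlt.le)]
      refine (one_add_abs_log_pow_le (by linarith) hpos (by nlinarith) hle
        (by linarith [norm_nonneg (boxCenter Q + τ • (t - boxCenter Q))])).trans ?_
      rw [Real.log_mul hτ.ne' (by positivity)]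
      have hlτ : 0 ≤ -Real.log (1 - τ) :=
        neg_nonneg.2 (Real.log_nonpos hτ.le (by linarith))
      -- The inequality 1 + a + b ≤ (1 + a)(1 + b) separates the singularity in τ from the factor
      -- ln^u(1/h), which stays in the estimate.
      have h2 : 1 + -(Real.log (1 - τ) + Real.log (h / 2))
          ≤ (1 + -Real.log (1 - τ)) * (1 + -Real.log (h / 2)) := by nlinarith
      calc 2 * (1 + -(Real.log (1 - τ) + Real.log (h / 2))) ^ u
          ≤ 2 * ((1 + -Real.log (1 - τ)) * (1 + -Real.log (h / 2))) ^ u := by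
            gcongr
            linarith
        _ ≤ 2 * ((2 * u) ^ u / √(1 - τ) * (1 + -Real.log (h / 2)) ^ u) := by
            rw [mul_pow]
            gcongr
            exact one_add_neg_log_pow_le hu hτ (by linarith)
        _ = _ := by ring)
  refine key.trans ?_
  have hd : ‖t - boxCenter Q‖ ≤ h := norm_sub_boxCenter_le hh.le (fun j => (hedge j).2) ht
  calc _ ≤ 2 * (2 * ((2 * u) ^ u * (1 + -Real.log (h / 2)) ^ u) * (l * h) ^ r) := by gcongr
    _ = _ := by ring

/-- Local approximation on the cells at a positive distance from the boundary of the cube. -/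
theorem IsQbar.abs_sub_taylorPoly_le_inner {l r γ u N k : ℕ} {v : ℝ} (hl : 2 ≤ l)
    (hγ : 1 ≤ γ) (hv : 1 ≤ v) (hk0 : 1 ≤ k) (hk : k < N) {f : (Fin l → ℝ) → ℝ}
    (hf : IsQbar l r γ u f) (P : GradedPartition v N) {Q : Fin l → ℝ × ℝ} (hQ : Q ∈ P.cells l k)
    {t : Fin l → ℝ} (ht : t ∈ box Q) :
    |f t - taylorPoly f (r + γ) (boxCenter Q) t| ≤
      4 * (1 + -Real.log (gradRadius v N k)) ^ (u - 1) *
        ((l * gradStep v N k) ^ (r + γ) / gradRadius v N k ^ γ) := by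
  have hN : 1 ≤ N := by omega
  have hh := gradStep_pos hv hN k
  have hρ : 0 < gradRadius v N k :=
    gradRadius_zero hv N ▸ gradRadius_strictMono hv hN (by omega : 0 < k)
  have hρ1 := gradRadius_lt_one hv hN hk
  have hlog : 0 ≤ -Real.log (gradRadius v N k) :=
    neg_nonneg.2 (Real.log_nonpos hρ.le hρ1.le)
  have hnorm : ∀ x ∈ box Q, ‖x‖ ≤ 1 - gradRadius v N k :=
    fun x hx => P.norm_le_of_mem_box hv hk hQ.1 hx
  have hc := boxCenter_mem fun j => (P.lt_of_mem_cells hQ j).le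
  have key := abs_sub_taylorPoly_le (p := r + γ) (by omega) hf.contDiffOn.continuousOn
    hf.differentiableOn (by linarith [hnorm _ hc] : ‖boxCenter Q‖ < 1)
    (by linarith [hnorm _ ht] : ‖t‖ ≤ 1)
    (K := 2 * (1 + -Real.log (gradRadius v N k)) ^ (u - 1) / gradRadius v N k ^ γ)
    (by positivity) (fun τ h0 h1 j => by
      have hx := hnorm _ (segment_mem_box hc ht h0 h1.le)
      set x := boxCenter Q + τ • (t - boxCenter Q) with hxdef
      refine (hf.bound_high (r + γ) (by omega) le_rfl j x
        (mem_interior_cube_iff.2 (by linarith))).trans ?_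
      rw [bdist_eq hl (mem_cube_iff.2 (by linarith)), Nat.add_sub_cancel_left]
      have h2 := one_add_abs_log_pow_le (u := u - 1) (d := 1 - ‖x‖) (by linarith) hρ hρ1.le
        (by linarith) (by linarith [norm_nonneg x])
      -- The derivative is bounded on the whole cell; dividing by √(1 - τ) ≤ 1 only fits the form
      -- required by the Taylor estimate.
      have h3 : 0 < √(1 - τ) := Real.sqrt_pos.2 (by linarith)
      have h4 : √(1 - τ) ≤ 1 := Real.sqrt_le_one.2 (by linarith)
      calc _ ≤ 2 * (1 + -Real.log (gradRadius v N k)) ^ (u - 1) / gradRadius v N k ^ γ := by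
            gcongr
            linarith
        _ ≤ _ := le_div_self (by positivity) h3 h4)
  refine key.trans ?_
  have hd : ‖t - boxCenter Q‖ ≤ gradStep v N k :=
    norm_sub_boxCenter_le hh.le (fun j => (P.edges k hk _ (hQ.1 j)).2) ht
  calc _ ≤ 2 * (2 * (1 + -Real.log (gradRadius v N k)) ^ (u - 1) / gradRadius v N k ^ γ *
        (l * gradStep v N k) ^ (r + γ)) := by gcongr
    _ = _ := by ring

theorem neg_log_gradRadius_le {v : ℝ} {N k : ℕ} (hv : 1 ≤ v) (hk : 1 ≤ k) (hN : 1 ≤ N) :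
    -Real.log (gradRadius v N k) ≤ v * Real.log N := by
  have hN' : (0 : ℝ) < N := by positivity
  have hk' : (0 : ℝ) < k := by positivity
  have h1 : 0 ≤ Real.log k := Real.log_nonneg (by exact_mod_cast hk)
  rw [gradRadius, Real.log_rpow (by positivity), Real.log_div hk'.ne' hN'.ne']
  nlinarith

/-- Local approximation on all cells with the error `N^(-s) (1 + ln N)^u`. -/
theorem exists_local_approx {l r γ u : ℕ} {v : ℝ} (hl : 2 ≤ l) (hr : 1 ≤ r) (hγ : 1 ≤ γ)
    (hu : 1 ≤ u) (hv : 1 ≤ v) (hvr : v * r = ((r + γ : ℕ) : ℝ)) :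
    ∃ C : ℝ, 0 ≤ C ∧ ∀ N : ℕ, 1 ≤ N → ∀ (P : GradedPartition v N) (f : (Fin l → ℝ) → ℝ),
      IsQbar l r γ u f → ∀ k < N, ∀ Q ∈ P.cells l k, ∃ p ∈ tensorPoly (r + γ) l,
        ∀ t ∈ box Q, |f t - p t| ≤ C * ((1 + Real.log N) ^ u / (N : ℝ) ^ (r + γ)) := by
  set C₀ : ℝ := 4 * ((2 * u) ^ u * (2 + v) ^ u) * l ^ r with hC₀
  set C₁ : ℝ := 4 * (1 + v) ^ u * (l ^ (r + γ) * (v * 2 ^ (v - 1)) ^ (r + γ)) with hC₁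
  have hv0 : 0 ≤ v := by linarith
  refine ⟨C₀ + C₁, by positivity, fun N hN P f hf k hk Q hQ => ?_⟩
  have hN' : (0 : ℝ) < N := by positivity
  have hlogN : 0 ≤ Real.log N := Real.log_nonneg (by exact_mod_cast hN)
  have hE : 0 ≤ (1 + Real.log N) ^ u / (N : ℝ) ^ (r + γ) := by positivity
  rcases Nat.eq_zero_or_pos k with rfl | hk0
  · refine ⟨_, taylorPoly_mem_tensorPoly (by omega : r ≤ r + γ) f (boxCenter Q), fun t ht => ?_⟩
    refine (hf.abs_sub_taylorPoly_le_boundary hl hr hγ hu hv hN P hQ ht).trans ?_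
    have hh : gradStep v N 0 = (N : ℝ) ^ (-v) := by
      rw [gradStep, gradRadius_zero hv, sub_zero, gradRadius]
      simp only [zero_add, Nat.cast_one]
      rw [one_div, Real.inv_rpow hN'.le, Real.rpow_neg hN'.le]
    -- Here v r = s enters: h_0^r = N^(-vr).
    have hpow : gradStep v N 0 ^ r = ((N : ℝ) ^ (r + γ))⁻¹ := by
      rw [hh, ← Real.rpow_natCast, ← Real.rpow_mul hN'.le, neg_mul, hvr, Real.rpow_neg hN'.le,
        Real.rpow_natCast]
    have hlog : 1 + -Real.log (gradStep v N 0 / 2) ≤ (2 + v) * (1 + Real.log N) := by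
      rw [hh, Real.log_div (by positivity) two_ne_zero, Real.log_rpow hN']
      have : Real.log 2 ≤ 1 := by linarith [Real.log_two_lt_d9]
      nlinarith
    have hlog0 : 0 ≤ 1 + -Real.log (gradStep v N 0 / 2) := by
      have h1 := gradStep_pos hv hN 0
      have h2 := gradStep_le_one hv hN hk
      linarith [Real.log_nonpos (by positivity : 0 ≤ gradStep v N 0 / 2) (by linarith)]
    calc _ ≤ 4 * ((2 * u) ^ u * ((2 + v) * (1 + Real.log N)) ^ u) * (l * gradStep v N 0) ^ r := by
          have := (gradStep_pos hv hN 0).le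
          gcongr
      _ = C₀ * ((1 + Real.log N) ^ u / (N : ℝ) ^ (r + γ)) := by
          rw [mul_pow (l : ℝ), hpow, mul_pow (2 + v), hC₀]
          ring
      _ ≤ _ := mul_le_mul_of_nonneg_right (by
          have : 0 ≤ C₁ := by positivity
          linarith) hE
  · refine ⟨_, taylorPoly_mem_tensorPoly le_rfl f (boxCenter Q), fun t ht => ?_⟩
    refine (hf.abs_sub_taylorPoly_le_inner hl hγ hv hk0 hk P hQ ht).trans ?_
    have hk' : (1 : ℝ) ≤ k := by exact_mod_cast hk0
    have hx : 0 < (k : ℝ) / N := by positivity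
    have hρ : 0 < gradRadius v N k := by unfold gradRadius; positivity
    have hstep : gradStep v N k ≤ v * 2 ^ (v - 1) * (((k : ℝ) / N) ^ (v - 1) / N) := by
      refine (gradStep_le hv hN k).trans ?_
      -- k + 1 ≤ 2k, which needs k ≥ 1.
      have h1 : (((k : ℝ) + 1) / N) ^ (v - 1) ≤ 2 ^ (v - 1) * ((k : ℝ) / N) ^ (v - 1) := by
        rw [← Real.mul_rpow (by norm_num) hx.le, mul_div_assoc']
        exact Real.rpow_le_rpow (by positivity) (by gcongr; linarith) (by linarith)
      calc _ ≤ v * (2 ^ (v - 1) * ((k : ℝ) / N) ^ (v - 1) / N) := by gcongr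
        _ = _ := by ring
    -- The identity (v - 1)s = vγ: the grading balances h_k^s against ρ_k^γ.
    have hcancel : (((k : ℝ) / N) ^ (v - 1)) ^ (r + γ) = gradRadius v N k ^ γ := by
      rw [gradRadius, ← Real.rpow_natCast, ← Real.rpow_mul hx.le, ← Real.rpow_natCast,
        ← Real.rpow_mul hx.le]
      congr 1
      push_cast at hvr ⊢
      linarith
    have hfrac : (l * gradStep v N k) ^ (r + γ) / gradRadius v N k ^ γ ≤
        l ^ (r + γ) * (v * 2 ^ (v - 1)) ^ (r + γ) / (N : ℝ) ^ (r + γ) := by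
      rw [div_le_iff₀ (by positivity)]
      calc _ ≤ (l * (v * 2 ^ (v - 1) * (((k : ℝ) / N) ^ (v - 1) / N))) ^ (r + γ) := by
            have := (gradStep_pos hv hN k).le
            gcongr
        _ = _ := by
            rw [mul_pow, mul_pow (v * 2 ^ (v - 1)), div_pow, hcancel]
            ring
    have hlog := neg_log_gradRadius_le (v := v) hv hk0 hN
    have hlog0 : 0 ≤ -Real.log (gradRadius v N k) :=
      neg_nonneg.2 (Real.log_nonpos hρ.le (gradRadius_lt_one hv hN hk).le)
    have hpow : (1 + -Real.log (gradRadius v N k)) ^ (u - 1) ≤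
        (1 + v) ^ u * (1 + Real.log N) ^ u := by
      calc _ ≤ (1 + -Real.log (gradRadius v N k)) ^ u :=
            pow_le_pow_right₀ (by linarith) (Nat.sub_le u 1)
        _ ≤ ((1 + v) * (1 + Real.log N)) ^ u := by
            gcongr
            nlinarith
        _ = _ := mul_pow _ _ _
    calc _ ≤ 4 * ((1 + v) ^ u * (1 + Real.log N) ^ u) *
          (l ^ (r + γ) * (v * 2 ^ (v - 1)) ^ (r + γ) / (N : ℝ) ^ (r + γ)) := by
          have := (gradStep_pos hv hN k).le
          gcongr
      _ = C₁ * ((1 + Real.log N) ^ u / (N : ℝ) ^ (r + γ)) := by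
          rw [hC₁]
          ring
      _ ≤ _ := mul_le_mul_of_nonneg_right (by
          have : 0 ≤ C₀ := by positivity
          linarith) hE

/-! ### Counting cells and nodes -/

theorem card_piFinset_update {ι α : Type*} [Fintype ι] [DecidableEq ι] (I : Finset α)
    (j : ι) (e : α) :
    (Fintype.piFinset (Function.update (fun _ => I) j {e})).card
      = I.card ^ (Fintype.card ι - 1) := by
  rw [Fintype.card_piFinset, ← Finset.mul_prod_erase Finset.univ _ (Finset.mem_univ j),
    Function.update_self, Finset.card_singleton, one_mul,
    Finset.prod_congr rfl (g := fun _ => I.card) fun i hi => by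
      rw [Function.update_of_ne (Finset.ne_of_mem_erase hi)]]
  simp [Finset.card_erase_of_mem]

namespace GradedPartition

variable {v : ℝ} {N : ℕ} (P : GradedPartition v N) {s l k : ℕ}

theorem mem_piFinset_update_intervals {G : Finset ℝ} {j : Fin l} {e : ℝ × ℝ}
    {Q : Fin l → ℝ × ℝ} (he : e ∈ intervals G) :
    Q ∈ Fintype.piFinset (Function.update (fun _ => (intervals_finite G).toFinset) j {e}) ↔
      (∀ i, Q i ∈ intervals G) ∧ Q j = e := by
  rw [Fintype.mem_piFinset]
  constructor
  · intro h
    have hj : Q j = e := by simpa using h j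
    refine ⟨fun i => ?_, hj⟩
    rcases eq_or_ne i j with rfl | hij
    · exact hj ▸ he
    · simpa [Function.update_of_ne hij] using h i
  · rintro ⟨h, hj⟩ i
    rcases eq_or_ne i j with rfl | hij
    · simp [hj]
    · simpa [Function.update_of_ne hij] using h i

/-- Fix an end interval (any interval if N = 1) in one coordinate; the other l - 1 factors are free.
-/
theorem pow_le_ncard_cells (hv : 1 ≤ v) (hl : 2 ≤ l) (hN : 1 ≤ N) :
    (intervals (P.pts 0)).ncard ^ (l - 1) ≤ (P.cells l 0).ncard := by
  obtain ⟨e, he, hend⟩ : ∃ e ∈ intervals (P.pts 0),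
      0 + 1 < N → e = (halfWidth v N (0 + 1), halfWidth v N 0) := by
    rcases Nat.lt_or_ge (0 + 1) N with h | h
    · exact ⟨_, (P.end_mem_intervals hv h).1, fun _ => rfl⟩
    · have := halfWidth_pos hv hN (by omega : 0 < N)
      obtain ⟨p, hp, -⟩ := exists_interval (x := 0) (P.left_mem 0 (by omega))
        (P.right_mem 0 (by omega)) (by linarith) (by linarith) (by linarith)
      exact ⟨p, hp, fun h' => absurd h' (by omega)⟩
  have h1 := card_piFinset_update (intervals_finite (P.pts 0)).toFinset (⟨0, by omega⟩ : Fin l) e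
  rw [Fintype.card_fin, ← Set.ncard_eq_toFinset_card _ (intervals_finite (P.pts 0))] at h1
  rw [← h1, ← Set.ncard_coe_finset]
  refine Set.ncard_le_ncard (fun Q hQ => ?_) (P.cells_finite l 0)
  obtain ⟨h2, h3⟩ := (mem_piFinset_update_intervals he).1 hQ
  exact (P.mem_cells_iff hv hl (by omega)).2 ⟨h2, fun h => ⟨_, Or.inl (h3.trans (hend h))⟩⟩

/-- Some factor of a cell is one of three intervals: the two end intervals or, in the innermost
layer, the whole edge. There are l positions for it. -/
theorem ncard_cells_le (hv : 1 ≤ v) (hl : 2 ≤ l) (hk : k < N) :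
    (P.cells l k).ncard ≤ 3 * l * (intervals (P.pts k)).ncard ^ (l - 1) := by
  classical
  set I := (intervals_finite (P.pts k)).toFinset with hI
  let E : Finset (ℝ × ℝ) := {(halfWidth v N (k + 1), halfWidth v N k),
    (-halfWidth v N k, -halfWidth v N (k + 1)), (-halfWidth v N k, halfWidth v N k)}
  have hsub : P.cells l k ⊆ ↑((Finset.univ : Finset (Fin l)).biUnion fun j =>
      E.biUnion fun e => Fintype.piFinset (Function.update (fun _ => I) j {e})) := by
    intro Q hQ
    obtain ⟨h1, h2⟩ := (P.mem_cells_iff hv hl hk).1 hQ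
    obtain ⟨j, hj⟩ : ∃ j, Q j ∈ E := by
      rcases Nat.lt_or_ge (k + 1) N with h | h
      · obtain ⟨j, hj⟩ := h2 h
        refine ⟨j, ?_⟩
        rcases hj with hj | hj <;> simp [E, hj]
      · obtain rfl : k = N - 1 := by omega
        refine ⟨⟨0, by omega⟩, ?_⟩
        obtain ⟨h3, h4, h5, -⟩ := h1 ⟨0, by omega⟩
        rw [P.innermost, Finset.mem_insert, Finset.mem_singleton] at h3 h4
        have hpos := halfWidth_pos hv (by omega : 1 ≤ N) hk
        have : Q ⟨0, by omega⟩ = (-halfWidth v N (N - 1), halfWidth v N (N - 1)) := by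
          unfold halfWidth at *
          rcases h3 with h3 | h3 <;> rcases h4 with h4 | h4
          · linarith
          · exact Prod.ext h3 h4
          · linarith
          · linarith
        simp [E, this]
    simp only [Finset.coe_biUnion, Set.mem_iUnion]
    exact ⟨j, Finset.mem_coe.2 (Finset.mem_univ j), Q j, hj,
      (mem_piFinset_update_intervals (h1 j)).2 ⟨h1, rfl⟩⟩
  refine (Set.ncard_le_ncard hsub (Finset.finite_toSet _)).trans ?_
  rw [Set.ncard_coe_finset]
  refine (Finset.card_biUnion_le_card_mul _ _
    (3 * (intervals (P.pts k)).ncard ^ (l - 1)) fun j _ => ?_).trans ?_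
  · refine (Finset.card_biUnion_le_card_mul _ _
      ((intervals (P.pts k)).ncard ^ (l - 1)) fun e _ => ?_).trans ?_
    · rw [card_piFinset_update, Fintype.card_fin,
        ← Set.ncard_eq_toFinset_card _ (intervals_finite (P.pts k))]
    · exact Nat.mul_le_mul_right _ Finset.card_le_three
  · rw [Finset.card_univ, Fintype.card_fin]
    exact le_of_eq (by ring)

theorem ncard_intervals_le (hv : 1 ≤ v) (hk : k < N) :
    ((intervals (P.pts k)).ncard : ℝ) ≤ 3 * (N : ℝ) ^ v / ((k : ℝ) + 1) ^ (v - 1) := by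
  have hN : 1 ≤ N := by omega
  have hN' : (0 : ℝ) < N := by positivity
  have hh := gradStep_pos hv hN k
  have hh1 := gradStep_le_one hv hN hk
  have hρ := gradRadius_nonneg v N k
  have hpos := halfWidth_pos hv hN hk
  have h1 := (intervals_ncard_le_card (P.pts k)).trans (card_le_of_separated hh (P.abs_le k hk)
    fun x hx y hy => le_sub_of_mem_of_intervals (fun p hp => (P.edges k hk p hp).1) hx hy)
  have h2 : ((intervals (P.pts k)).ncard : ℝ) ≤ 3 / gradStep v N k := by
    calc ((intervals (P.pts k)).ncard : ℝ)
        ≤ (⌊2 * halfWidth v N k / gradStep v N k⌋₊ : ℝ) + 1 := by exact_mod_cast h1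
      _ ≤ 2 * halfWidth v N k / gradStep v N k + 1 := by
          gcongr
          exact Nat.floor_le (by positivity)
      _ ≤ 3 / gradStep v N k := by
          rw [div_add_one hh.ne']
          gcongr
          unfold halfWidth
          linarith
  refine h2.trans ?_
  calc 3 / gradStep v N k ≤ 3 / ((((k : ℝ) + 1) / N) ^ (v - 1) / N) := by
        gcongr
        exact le_gradStep hv hN k
    _ = _ := by
        rw [Real.div_rpow (by positivity) hN'.le, Real.rpow_sub_one hN'.ne']
        field_simp

/-- The boundary layer alone suffices: gaps of length at most 2N^(-v) must cover [-1, 1], so there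
are at least N^v of them. -/
theorem le_numNodes (hv : 1 ≤ v) (hl : 2 ≤ l) (hN : 1 ≤ N) :
    (s : ℝ) ^ l * (N : ℝ) ^ (v * ((l : ℝ) - 1)) ≤ P.numNodes s l := by
  have hN' : (0 : ℝ) < N := by positivity
  have hh := gradStep_pos hv hN 0
  have hstep : gradStep v N 0 = (N : ℝ) ^ (-v) := by
    rw [gradStep, gradRadius_zero hv, sub_zero, gradRadius]
    simp only [zero_add, Nat.cast_one]
    rw [one_div, Real.inv_rpow hN'.le, Real.rpow_neg hN'.le]
  have h1 := sub_le_ncard_intervals_mul (G := P.pts 0) (P.left_mem 0 (by omega))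
    (P.right_mem 0 (by omega)) (by rw [gradRadius_zero hv]; norm_num)
    (by positivity : 0 ≤ 2 * gradStep v N 0) fun p hp => (P.edges 0 (by omega) p hp).2
  rw [gradRadius_zero hv, hstep, Real.rpow_neg hN'.le] at h1
  have h2 : (N : ℝ) ^ v ≤ (intervals (P.pts 0)).ncard := by
    have : 0 < (N : ℝ) ^ v := by positivity
    field_simp at h1
    linarith
  have h3 : (N : ℝ) ^ (v * ((l : ℝ) - 1)) ≤ (P.cells l 0).ncard := by
    calc (N : ℝ) ^ (v * ((l : ℝ) - 1)) = ((N : ℝ) ^ v) ^ (l - 1) := by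
          rw [Real.rpow_mul hN'.le, ← Real.rpow_natCast, Nat.cast_sub (by omega), Nat.cast_one]
      _ ≤ ((intervals (P.pts 0)).ncard : ℝ) ^ (l - 1) := by gcongr
      _ ≤ _ := by exact_mod_cast P.pow_le_ncard_cells hv hl hN
  have h4 : s ^ l * (P.cells l 0).ncard ≤ P.numNodes s l :=
    Finset.single_le_sum (f := fun k => s ^ l * (P.cells l k).ncard) (fun _ _ => Nat.zero_le _)
      (Finset.mem_range.2 (by omega))
  calc _ ≤ (s : ℝ) ^ l * (P.cells l 0).ncard := by gcongr
    _ ≤ _ := by exact_mod_cast h4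

/-- The counts of the layers are dominated by a convergent series in (k+1)^(-a) with a = (v-1)(l-1)
> 1. -/
theorem exists_numNodes_le (s : ℕ) (hv : 1 ≤ v) (hl : 2 ≤ l)
    (hvl : 1 < (v - 1) * ((l : ℝ) - 1)) :
    ∃ C : ℝ, 0 ≤ C ∧ ∀ N : ℕ, 1 ≤ N → ∀ P : GradedPartition v N,
      (P.numNodes s l : ℝ) ≤ C * (N : ℝ) ^ (v * ((l : ℝ) - 1)) := by
  set a := (v - 1) * ((l : ℝ) - 1) with ha
  have hsum : Summable fun k : ℕ => 1 / ((k : ℝ) + 1) ^ a := by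
    have := (summable_nat_add_iff 1).2 (Real.summable_one_div_nat_rpow.2 hvl)
    simpa using this
  refine ⟨s ^ l * (3 * l * 3 ^ (l - 1)) * ∑' k : ℕ, 1 / ((k : ℝ) + 1) ^ a,
    mul_nonneg (by positivity) (tsum_nonneg fun _ => by positivity), fun N hN P => ?_⟩
  have hN' : (0 : ℝ) < N := by positivity
  have hterm : ∀ k ∈ Finset.range N, ((s ^ l * (P.cells l k).ncard : ℕ) : ℝ) ≤
      s ^ l * (3 * l * 3 ^ (l - 1)) * (N : ℝ) ^ (v * ((l : ℝ) - 1)) * (1 / ((k : ℝ) + 1) ^ a) := by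
    intro k hk
    have hk' := Finset.mem_range.1 hk
    have h1 : ((P.cells l k).ncard : ℝ) ≤
        3 * l * ((intervals (P.pts k)).ncard : ℝ) ^ (l - 1) := by
      exact_mod_cast P.ncard_cells_le hv hl hk'
    push_cast
    calc (s : ℝ) ^ l * (P.cells l k).ncard
        ≤ s ^ l * (3 * l * (3 * (N : ℝ) ^ v / ((k : ℝ) + 1) ^ (v - 1)) ^ (l - 1)) := by
          refine mul_le_mul_of_nonneg_left (h1.trans ?_) (by positivity)
          gcongr
          exact P.ncard_intervals_le hv hk'
      _ = _ := by
          have e1 : ((N : ℝ) ^ v) ^ (l - 1) = (N : ℝ) ^ (v * ((l : ℝ) - 1)) := by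
            rw [Real.rpow_mul hN'.le, ← Real.rpow_natCast, Nat.cast_sub (by omega), Nat.cast_one]
          have e2 : (((k : ℝ) + 1) ^ (v - 1)) ^ (l - 1) = ((k : ℝ) + 1) ^ a := by
            rw [ha, Real.rpow_mul (by positivity), ← Real.rpow_natCast, Nat.cast_sub (by omega),
              Nat.cast_one]
          rw [div_pow, mul_pow, e1, e2]
          ring
  rw [numNodes, Nat.cast_sum]
  refine (Finset.sum_le_sum hterm).trans ?_
  rw [← Finset.mul_sum]
  calc _ ≤ s ^ l * (3 * l * 3 ^ (l - 1)) * (N : ℝ) ^ (v * ((l : ℝ) - 1)) *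
        ∑' k : ℕ, 1 / ((k : ℝ) + 1) ^ a := by
        gcongr
        exact hsum.sum_le_tsum _ fun _ _ => by positivity
    _ = _ := by ring

end GradedPartition

/-! ### Kolmogorov widths -/

/-- Widths use subspaces of dimension exactly n, while the spline range only has dimension at most
n; vectors are added one at a time. -/
theorem exists_submodule_ge_finrank_eq {V : Type*} [AddCommGroup V] [Module ℝ V]
    (hV : ¬ FiniteDimensional ℝ V) {n : ℕ} (L : Submodule ℝ V) [FiniteDimensional ℝ L]
    (hL : Module.finrank ℝ L ≤ n) :
    ∃ L' : Submodule ℝ V, L ≤ L' ∧ FiniteDimensional ℝ L' ∧ Module.finrank ℝ L' = n := by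
  induction n, hL using Nat.le_induction with
  | base => exact ⟨L, le_rfl, inferInstance, rfl⟩
  | succ n _ ih =>
    obtain ⟨L', hLL', hfd, hn⟩ := ih
    have hne : L' ≠ ⊤ := by
      rintro rfl
      exact hV (Submodule.topEquiv.finiteDimensional (K := ℝ) (V := (⊤ : Submodule ℝ V)))
    obtain ⟨x, hx⟩ : ∃ x, x ∉ L' := by
      by_contra! h
      exact hne (Submodule.eq_top_iff'.2 h)
    have hlt : L' < L' ⊔ Submodule.span ℝ {x} :=
      lt_of_le_of_ne le_sup_left fun h => hx (h ▸ Submodule.mem_sup_right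
        (Submodule.mem_span_singleton_self x))
    have h1 := Submodule.finrank_lt_finrank_of_lt hlt
    have h2 := Submodule.finrank_add_le_finrank_add_finrank L' (Submodule.span ℝ {x})
    have h3 := finrank_span_le_card (R := ℝ) ({x} : Set V)
    simp only [Set.toFinset_singleton, Finset.card_singleton] at h3
    exact ⟨L' ⊔ Submodule.span ℝ {x}, hLL'.trans le_sup_left, inferInstance, by omega⟩

theorem not_finiteDimensional_continuousMap_cube {l : ℕ} (hl : 2 ≤ l) :
    ¬ FiniteDimensional ℝ C(cube l, ℝ) := by
  intro h
  let j₀ : Fin l := ⟨0, by omega⟩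
  let T : Polynomial ℝ →ₗ[ℝ] C(cube l, ℝ) :=
    { toFun p := ⟨fun t => p.eval (t.1 j₀),
        p.continuous.comp ((continuous_apply j₀).comp continuous_subtype_val)⟩
      map_add' p q := by ext; simp
      map_smul' c p := by ext; simp }
  refine Polynomial.not_finite (R := ℝ) (FiniteDimensional.of_injective T ?_)
  rw [← LinearMap.ker_eq_bot, LinearMap.ker_eq_bot']
  intro p hp
  refine Polynomial.eq_zero_of_infinite_isRoot p
    ((Set.Icc_infinite (show (-1 : ℝ) < 1 by norm_num)).mono fun x hx => ?_)
  have ht : (fun _ : Fin l => x) ∈ cube l := ⟨fun _ => hx.1, fun _ => hx.2⟩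
  exact DFunLike.congr_fun hp ⟨_, ht⟩

theorem kolmogorovWidth_le {B : Type*} [NormedAddCommGroup B] [NormedSpace ℝ B]
    (hB : ¬ FiniteDimensional ℝ B) {n : ℕ} {X : Set B} (L : Submodule ℝ B)
    [FiniteDimensional ℝ L] (hL : Module.finrank ℝ L ≤ n) {e : ℝ}
    (h : ∀ x ∈ X, ∃ y ∈ L, ‖x - y‖ ≤ e) : kolmogorovWidth n X ≤ ENNReal.ofReal e := by
  obtain ⟨L', hLL', hfd, hn⟩ := exists_submodule_ge_finrank_eq hB L hL
  refine (iInf₂_le L' ⟨hfd, hn⟩).trans (iSup₂_le fun x hx => ?_)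
  obtain ⟨y, hy, hxy⟩ := h x hx
  refine (Metric.infEDist_le_edist_of_mem (hLL' hy)).trans ?_
  rw [edist_dist, dist_eq_norm]
  exact ENNReal.ofReal_le_ofReal hxy

theorem norm_le_one_of_mem_Qbar {l r γ u : ℕ} {f : C(cube l, ℝ)} (hf : f ∈ Qbar l r γ u) :
    ‖f‖ ≤ 1 := by
  obtain ⟨F, hF, hFf⟩ := hf
  refine (ContinuousMap.norm_le _ zero_le_one).2 fun t => ?_
  have := hF.bound_low 0 (Nat.zero_le _) Fin.elim0 t t.2
  rw [iteratedFDerivWithin_zero_apply] at this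
  rw [hFf t, Real.norm_eq_abs]
  exact this

/-! ### The error in terms of the number of nodes -/

/-- The error of the local spline operator in terms of the number of layers. -/
theorem exists_norm_sub_splineMap_le {l r γ u : ℕ} {v : ℝ} (hl : 2 ≤ l) (hr : 1 ≤ r) (hγ : 1 ≤ γ)
    (hu : 1 ≤ u) (hv : 1 ≤ v) (hvr : v * r = ((r + γ : ℕ) : ℝ)) (hs : 2 ≤ r + γ) :
    ∃ C : ℝ, 0 ≤ C ∧ ∀ (N : ℕ) (hN : 1 ≤ N) (P : GradedPartition v N), ∀ f ∈ Qbar l r γ u,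
      ‖f - P.splineMap hv hl hs hN f‖ ≤ C * ((1 + Real.log N) ^ u / (N : ℝ) ^ (r + γ)) := by
  obtain ⟨C₁, hC₁, h1⟩ := exists_local_approx hl hr hγ hu hv hvr
  obtain ⟨C₂, hC₂, h2⟩ := GradedPartition.exists_abs_sub_spline_le hl hs
  refine ⟨C₂ * C₁, by positivity, fun N hN P f hf => ?_⟩
  have hlogN : 0 ≤ Real.log N := Real.log_nonneg (by exact_mod_cast hN)
  obtain ⟨F, hF, hFf⟩ := hf
  have hzF : ∀ x ∈ cube l, zeroExtend l f x = F x := fun x hx =>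
    (zeroExtend_apply f ⟨x, hx⟩).trans (hFf ⟨x, hx⟩)
  refine (ContinuousMap.norm_le _ (by positivity)).2 fun t => ?_
  have := h2 P hv hN (zeroExtend l f) _ (fun k hk Q hQ => by
    obtain ⟨p, hp, hpt⟩ := h1 N hN P F hF k hk Q hQ
    exact ⟨p, hp, fun t ht => by
      rw [hzF t (hQ.2 ht).1]
      exact hpt t ht⟩) t t.2
  rw [zeroExtend_apply, ← mul_assoc] at this
  exact this

/-- Conversion of an error bound in terms of the number `N` of layers into one in terms of a
number `n` comparable to `N ^ W`. -/
theorem div_pow_le_rpow_mul_log_pow {N n u s : ℕ} {W β A B : ℝ} (hN : 1 ≤ N) (hn : 1 ≤ n)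
    (hβ : 0 ≤ β) (hW : W * β = s) (hA : 0 ≤ A) (hB : 0 ≤ B)
    (hlog : 1 + Real.log N ≤ A * Real.log n) (hnN : (n : ℝ) ≤ B * (N : ℝ) ^ W) :
    (1 + Real.log N) ^ u / (N : ℝ) ^ s ≤ A ^ u * B ^ β * (n : ℝ) ^ (-β) * Real.log n ^ u := by
  have hN' : (0 : ℝ) < N := by positivity
  have hn' : (0 : ℝ) < n := by positivity
  have hlogN : 0 ≤ Real.log N := Real.log_nonneg (by exact_mod_cast hN)
  have h1 : (n : ℝ) ^ β ≤ B ^ β * (N : ℝ) ^ s := by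
    calc (n : ℝ) ^ β ≤ (B * (N : ℝ) ^ W) ^ β := by gcongr
      _ = _ := by
        rw [Real.mul_rpow hB (by positivity), ← Real.rpow_mul hN'.le, hW, Real.rpow_natCast]
  have h2 : 1 / (N : ℝ) ^ s ≤ B ^ β * (n : ℝ) ^ (-β) := by
    rw [Real.rpow_neg hn'.le, ← div_eq_mul_inv, div_le_div_iff₀ (by positivity) (by positivity)]
    linarith
  calc (1 + Real.log N) ^ u / (N : ℝ) ^ s = (1 + Real.log N) ^ u * (1 / (N : ℝ) ^ s) := by ring
    _ ≤ (A * Real.log n) ^ u * (B ^ β * (n : ℝ) ^ (-β)) := by gcongr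
    _ = _ := by rw [mul_pow]; ring

theorem theorem3p3 (l r γ u s : ℕ) (v : ℝ) (hl : 2 ≤ l) (hr : 1 ≤ r) (hγ : 1 ≤ γ) (hu : 1 ≤ u)
    (hs : s = r + γ) (hv : v = (s : ℝ) / ((s : ℝ) - γ)) (hvl : (l : ℝ) / ((l : ℝ) - 1) < v) :
    ∃ c : ℝ, 0 < c ∧
      (∀ n : ℕ, 2 ≤ n →
        kolmogorovWidth n (Qbar l r γ u) ≤
          ENNReal.ofReal
            (c * (n : ℝ) ^ (-(((s : ℝ) - γ) / ((l : ℝ) - 1))) * Real.log n ^ u)) ∧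
      ∀ N : ℕ, 1 ≤ N →
        Nonempty (GradedPartition v N) ∧
        ∀ P : GradedPartition v N,
          c⁻¹ * (N : ℝ) ^ (v * ((l : ℝ) - 1)) ≤ P.numNodes s l ∧
          (P.numNodes s l : ℝ) ≤ c * (N : ℝ) ^ (v * ((l : ℝ) - 1)) ∧
          ∃ S : C(cube l, ℝ) →ₗ[ℝ] C(cube l, ℝ),
            (∀ f g, P.IsLocalSpline s f g ↔ g = S f) ∧
            FiniteDimensional ℝ (LinearMap.range S) ∧
            Module.finrank ℝ (LinearMap.range S) ≤ P.numNodes s l ∧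
            ∀ f ∈ Qbar l r γ u,
              ‖f - S f‖ ≤ c * (P.numNodes s l : ℝ) ^ (-(((s : ℝ) - γ) / ((l : ℝ) - 1))) *
                Real.log (P.numNodes s l) ^ u := by
  have hr' : (1 : ℝ) ≤ r := by exact_mod_cast hr
  have hl' : (2 : ℝ) ≤ l := by exact_mod_cast hl
  have hs2 : 2 ≤ s := by omega
  have hsr : (s : ℝ) - γ = r := by rw [hs]; push_cast; ring
  have hvr : v * r = s := by
    rw [hv, hsr]
    field_simp
  have hl1 : 0 < (l : ℝ) - 1 := by linarith
  set W := v * ((l : ℝ) - 1) with hWdef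
  have hWl : (l : ℝ) < W := (div_lt_iff₀ hl1).1 hvl
  have hv1 : 1 ≤ v := ((one_le_div hl1).2 (by linarith)).trans hvl.le
  set β := ((s : ℝ) - γ) / ((l : ℝ) - 1) with hβdef
  have hβ : 0 ≤ β := by
    rw [hβdef, hsr]
    positivity
  have hWβ : W * β = s := by
    rw [hWdef, hβdef, hsr, ← hvr]
    field_simp
  subst hs
  obtain ⟨C₁, hC₁, herr⟩ := exists_norm_sub_splineMap_le (u := u) hl hr hγ hu hv1 hvr hs2
  obtain ⟨C₂', hC₂', hnum'⟩ := GradedPartition.exists_numNodes_le (r + γ) hv1 hl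
    (by rw [sub_mul]; linarith : 1 < (v - 1) * ((l : ℝ) - 1))
  set C₂ := max C₂' 1 with hC₂def
  have hC₂1 : 1 ≤ C₂ := le_max_right _ _
  have hnum : ∀ N : ℕ, 1 ≤ N → ∀ P : GradedPartition v N,
      (P.numNodes (r + γ) l : ℝ) ≤ C₂ * (N : ℝ) ^ W := fun N hN P =>
    (hnum' N hN P).trans (mul_le_mul_of_nonneg_right (le_max_left _ _) (by positivity))
  have hlog2 : 1 / 2 ≤ Real.log 2 := by linarith [Real.log_two_gt_d9]
  -- The factor 2^W pays for rounding the number of layers down to an integer.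
  set B := C₂ * 2 ^ W with hBdef
  have hW0 : 0 ≤ W := by linarith
  have hCB : C₂ ≤ B := by
    have : (1 : ℝ) ≤ 2 ^ W := Real.one_le_rpow one_le_two hW0
    nlinarith
  have hB1 : 1 ≤ B := hC₂1.trans hCB
  have hBβ : 1 ≤ B ^ β := Real.one_le_rpow hB1 hβ
  have hlogpos : ∀ n : ℕ, 2 ≤ n → 1 / 2 ≤ Real.log n := fun n hn =>
    hlog2.trans (Real.log_le_log two_pos (by exact_mod_cast hn))
  -- The first summand serves the error bounds, with C₁ + 1 so that small n are covered; C₂ serves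
  -- the node count and gives c ≥ 1. The 3 comes from 1 + ln N ≤ 3 ln n, as ln n ≥ 1/2.
  set c := (C₁ + 1) * (3 ^ u * B ^ β) + C₂ with hcdef
  have hmain : 0 ≤ (C₁ + 1) * (3 ^ u * B ^ β) := by positivity
  have hcle : ∀ x y : ℝ, 0 ≤ x → 0 ≤ y → (C₁ + 1) * (3 ^ u * B ^ β * x * y) ≤ c * x * y :=
    fun x y hx hy => by
      have := mul_nonneg (mul_nonneg (by linarith : 0 ≤ C₂) hx) hy
      calc _ = (C₁ + 1) * (3 ^ u * B ^ β) * x * y := by ring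
        _ ≤ _ := by rw [hcdef, add_mul, add_mul]; linarith
  have hconv : ∀ N n : ℕ, 1 ≤ N → 2 ≤ n → Real.log N ≤ Real.log n →
      (n : ℝ) ≤ B * (N : ℝ) ^ W →
      C₁ * ((1 + Real.log N) ^ u / (N : ℝ) ^ (r + γ)) ≤
        c * (n : ℝ) ^ (-β) * Real.log n ^ u := by
    intro N n hN hn hlog hnN
    have hl0 := hlogpos n hn
    have hlogN : 0 ≤ Real.log N := Real.log_nonneg (by exact_mod_cast hN)
    have h1 := div_pow_le_rpow_mul_log_pow (u := u) hN (by omega : 1 ≤ n) hβ hWβ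
      (by norm_num : (0 : ℝ) ≤ 3) (by linarith) (by linarith) hnN
    refine le_trans ?_ (hcle _ _ (by positivity) (by positivity))
    refine mul_le_mul (by linarith) h1 (by positivity) (by positivity)
  refine ⟨c, by linarith, fun n hn => ?_, fun N hN => ⟨nonempty_gradedPartition hv1 hN, fun P => ?_⟩⟩
  · have hl0 := hlogpos n hn
    have hn' : (0 : ℝ) < n := by positivity
    have hinf := not_finiteDimensional_continuousMap_cube hl
    -- The floor is the largest N with C₂ N^W ≤ n. If it is 0, then n ≤ B is bounded and
    -- approximation by 0 suffices, since ‖f‖ ≤ 1.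
    rcases Nat.lt_or_ge ⌊((n : ℝ) / C₂) ^ W⁻¹⌋₊ 1 with hN | hN
    · refine kolmogorovWidth_le hinf ⊥ (by simp) fun f hf => ⟨0, Submodule.zero_mem _, ?_⟩
      rw [sub_zero]
      refine (norm_le_one_of_mem_Qbar hf).trans (le_trans ?_
        (hcle _ _ (by positivity) (by positivity)))
      have h1 : (n : ℝ) ≤ B := by
        refine le_trans ?_ hCB
        by_contra! h
        have h2 : 1 ≤ ((n : ℝ) / C₂) ^ W⁻¹ :=
          Real.one_le_rpow ((one_le_div (by linarith)).2 h.le) (by positivity)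
        exact absurd ((Nat.one_le_floor_iff _).2 h2) (by omega)
      have h2 : 1 ≤ B ^ β * (n : ℝ) ^ (-β) := by
        rw [Real.rpow_neg hn'.le, ← div_eq_mul_inv, one_le_div (by positivity)]
        exact Real.rpow_le_rpow hn'.le h1 hβ
      have h3 : 1 ≤ (3 * Real.log n) ^ u := one_le_pow₀ (by linarith)
      calc (1 : ℝ) ≤ (C₁ + 1) * ((B ^ β * (n : ℝ) ^ (-β)) * (3 * Real.log n) ^ u) :=
            one_le_mul_of_one_le_of_one_le (by linarith) (one_le_mul_of_one_le_of_one_le h2 h3)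
        _ = _ := by rw [mul_pow]; ring
    · set N := ⌊((n : ℝ) / C₂) ^ W⁻¹⌋₊ with hNdef
      have hN' : (1 : ℝ) ≤ N := by exact_mod_cast hN
      have hx0 : 0 ≤ ((n : ℝ) / C₂) ^ W⁻¹ := by positivity
      have hxW : (((n : ℝ) / C₂) ^ W⁻¹) ^ W = n / C₂ := by
        rw [← Real.rpow_mul (by positivity), inv_mul_cancel₀ (by linarith), Real.rpow_one]
      have hNle : C₂ * (N : ℝ) ^ W ≤ n := by
        have : (N : ℝ) ^ W ≤ n / C₂ := by
          rw [← hxW]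
          exact Real.rpow_le_rpow (by positivity) (Nat.floor_le hx0) hW0
        rwa [le_div_iff₀ (by linarith), mul_comm] at this
      have hnB : (n : ℝ) ≤ B * (N : ℝ) ^ W := by
        have h1 : ((n : ℝ) / C₂) ^ W⁻¹ ≤ 2 * N := by
          linarith [Nat.lt_floor_add_one (((n : ℝ) / C₂) ^ W⁻¹)]
        have h2 : (n : ℝ) / C₂ ≤ (2 * N) ^ W := by
          rw [← hxW]
          exact Real.rpow_le_rpow hx0 h1 hW0
        rw [Real.mul_rpow two_pos.le (by positivity), div_le_iff₀ (by linarith)] at h2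
        rw [hBdef]
        linarith
      have hNn : Real.log N ≤ Real.log n := by
        refine Real.log_le_log (by linarith) (le_trans ?_ hNle)
        have h1 : (N : ℝ) ≤ (N : ℝ) ^ W := by
          conv_lhs => rw [← Real.rpow_one (N : ℝ)]
          exact Real.rpow_le_rpow_of_exponent_le hN' (by linarith)
        nlinarith
      obtain ⟨P⟩ := nonempty_gradedPartition hv1 hN
      obtain ⟨hfd, hrank⟩ := P.finrank_range_splineMap_le hv1 hl hs2 hN
      refine kolmogorovWidth_le hinf (LinearMap.range (P.splineMap hv1 hl hs2 hN))
        (hrank.trans (by exact_mod_cast (hnum N hN P).trans hNle)) fun f hf =>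
          ⟨_, LinearMap.mem_range_self _ f, (herr N hN P f hf).trans ?_⟩
      exact hconv N n hN hn hNn hnB
  · have hlow := P.le_numNodes (s := r + γ) hv1 hl hN
    have hN' : (1 : ℝ) ≤ N := by exact_mod_cast hN
    have hNW : (1 : ℝ) ≤ (N : ℝ) ^ W := Real.one_le_rpow hN' hW0
    -- Even for N = 1 there are at least s^l ≥ 2 nodes, so the logarithm of n stays away from 0.
    have hsl : (2 : ℝ) ≤ ((r + γ : ℕ) : ℝ) ^ l := by
      have h1 : (2 : ℝ) ≤ ((r + γ : ℕ) : ℝ) := by exact_mod_cast hs2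
      exact h1.trans (le_self_pow₀ (by linarith) (by omega))
    have hNn : (N : ℝ) ^ W ≤ P.numNodes (r + γ) l := by nlinarith
    have hn2 : 2 ≤ P.numNodes (r + γ) l := by
      have : (2 : ℝ) ≤ P.numNodes (r + γ) l := by nlinarith
      exact_mod_cast this
    have hc1 : 1 ≤ c := by linarith
    refine ⟨?_, ?_, P.splineMap hv1 hl hs2 hN, P.isLocalSpline_iff hv1 hl hs2 hN,
      (P.finrank_range_splineMap_le hv1 hl hs2 hN).1,
      (P.finrank_range_splineMap_le hv1 hl hs2 hN).2, fun f hf =>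
        (herr N hN P f hf).trans (hconv N _ hN hn2 ?_ ?_)⟩
    · refine le_trans ?_ hNn
      exact mul_le_of_le_one_left (by positivity) (inv_le_one_of_one_le₀ hc1)
    · refine (hnum N hN P).trans (mul_le_mul_of_nonneg_right ?_ (by positivity))
      linarith
    · refine Real.log_le_log (by linarith) (le_trans ?_ hNn)
      conv_lhs => rw [← Real.rpow_one (N : ℝ)]
      exact Real.rpow_le_rpow_of_exponent_le hN' (by linarith)
    · exact (hnum N hN P).trans (mul_le_mul_of_nonneg_right hCB (by positivity))
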